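/- Let $M$ be a nonempty smooth (Hausdorff, second countable) manifold of dimension $2n+s$, $n\ge 1$, $s\ge 1$, with a Riemannian metric $g$ and its Levi-Civita connection $\nabla$. Let $(f,Q,\xi_i,\eta^i,g)$ be a weak metric $f$-structure on $M$: $f$ is a smooth $g$-skew-symmetric $(1,1)$-tensor field of rank $2n$, $Q$ is a smooth self-adjoint nonsingular $(1,1)$-tensor field, $\xi_1,\dots,\xi_s$ are smooth orthonormal vector fields and $\eta^1,\dots,\eta^s$ are smooth 1-forms such that, for all vector fields $X,Y$, $$f^2=-Q+\sum_i\eta^i\otimes\xi_i,\qquad \eta^i(\xi_j)=\delta^i_j,\qquad Q\xi_i=\xi_i,\qquad g(fX,fY)=g(X,QY)-\sum_i\eta^i(X)\eta^i(Y).$$ Put $\bar\xi=\sum_i\xi_i$ and $\bar\eta=\sum_i\eta^i$. Assume that the structure is weak $\beta f$-Kenmotsu with a constant $\beta\neq 0$, that is, $$(\nabla_Xf)Y=\beta\{g(fX,Y)\,\bar\xi-\bar\eta(Y)\,fX\}\qquad\text{for all vector fields }X,Y.$$ Let $R_{X,Y}=[\nabla_X,\nabla_Y]-\nabla_{[X,Y]}$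 be the curvature tensor and let $\mathrm{Ric}^*(X,Y)=\tfrac12\,\mathrm{trace}\{Z\mapsto fR_{X,fY}Z\}$ be the $*$-Ricci tensor. Let $V$ be a smooth vector field on $M$ and $\lambda\in\mathbb R$ such that $(g,V)$ represents a $*$-Ricci soliton with soliton constant $\lambda$ (a $*$-$\eta$-Ricci soliton with $\mu=0$), that is, $$\tfrac12\mathcal L_Vg+\mathrm{Ric}^*=\lambda\Big\{g-\sum_i\eta^i\otimes\eta^i\Big\}+\lambda\,\bar\eta\otimes\bar\eta .$$ Then $\lambda=0$. -/

import Mathlib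

open Bundle VectorField
open scoped Manifold ContDiff

set_option linter.unusedSectionVars false

noncomputable section

namespace WeakKenmotsu

variable {E : Type*} [NormedAddCommGroup E] [NormedSpace ℝ E] [FiniteDimensional ℝ E]
  {M : Type*} [TopologicalSpace M] [ChartedSpace E M] [IsManifold 𝓘(ℝ, E) ∞ M]
  [RiemannianBundle (fun x : M ↦ TangentSpace 𝓘(ℝ, E) x)]
  [IsContMDiffRiemannianBundle 𝓘(ℝ, E) ∞ E (fun x : M ↦ TangentSpace 𝓘(ℝ, E) x)]

/-- The derivative at `x` of the function `g(Y, Z)` in the direction `X x`. -/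
def dirDerivInner (X Y Z : Π x : M, TangentSpace 𝓘(ℝ, E) x) (x : M) : ℝ :=
  mvfderiv 𝓘(ℝ, E) (fun y : M ↦ inner ℝ (Y y) (Z y)) x (X x)

/-- The Koszul expression for `g(∇_X Y, Z)`. -/
def koszul (X Y Z : Π x : M, TangentSpace 𝓘(ℝ, E) x) (x : M) : ℝ :=
  (1 / 2 : ℝ) * (dirDerivInner X Y Z x + dirDerivInner Y Z X x - dirDerivInner Z X Y x
    + inner ℝ (mlieBracket 𝓘(ℝ, E) X Y x) (Z x) - inner ℝ (mlieBracket 𝓘(ℝ, E) Y Z x) (X x)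
    + inner ℝ (mlieBracket 𝓘(ℝ, E) Z X x) (Y x))

variable {X X' Y Y' Z Z' : Π x : M, TangentSpace 𝓘(ℝ, E) x} {x : M} {h : M → ℝ}

theorem mdiff_inner (hY : MDiffAt (T% Y) x) (hZ : MDiffAt (T% Z) x) :
   MDiffAt (fun y : M ↦ (inner ℝ (Y y) (Z y) : ℝ)) x :=
  MDifferentiableAt.inner_bundle (E := fun x : M ↦ TangentSpace 𝓘(ℝ, E) x) hY hZ

theorem dirDerivInner_smul₁ : dirDerivInner (h • X) Y Z x = h x * dirDerivInner X Y Z x := by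
  simp [dirDerivInner]

theorem dirDerivInner_add₁ :
    dirDerivInner (X + X') Y Z x = dirDerivInner X Y Z x + dirDerivInner X' Y Z x := by
  simp [dirDerivInner]

theorem dirDerivInner_comm : dirDerivInner X Y Z x = dirDerivInner X Z Y x := by
  simp [dirDerivInner, real_inner_comm]

theorem dirDerivInner_add₂ (hY : MDiffAt (T% Y) x) (hY' : MDiffAt (T% Y') x)
    (hZ : MDiffAt (T% Z) x) :
    dirDerivInner X (Y + Y') Z x = dirDerivInner X Y Z x + dirDerivInner X Y' Z x := by
  simp [dirDerivInner, inner_add_left, mvfderiv_fun_add (mdiff_inner hY hZ) (mdiff_inner hY' hZ)]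

theorem dirDerivInner_smul₂ (hh : MDiffAt h x) (hY : MDiffAt (T% Y) x) (hZ : MDiffAt (T% Z) x) :
    dirDerivInner X (h • Y) Z x = h x * dirDerivInner X Y Z x
      + mvfderiv 𝓘(ℝ, E) h x (X x) * inner ℝ (Y x) (Z x) := by
  simp [dirDerivInner, inner_smul_left, mvfderiv_fun_mul hh (mdiff_inner hY hZ)]
  ring

instance instFiniteDimensionalTangentSpaceSelf (x : M) :
    FiniteDimensional ℝ (TangentSpace 𝓘(ℝ, E) x) :=
  inferInstanceAs (FiniteDimensional ℝ E)

theorem koszul_tensorial_left (hY : MDiffAt (T% Y) x) (hZ : MDiffAt (T% Z) x) :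
    TensorialAt 𝓘(ℝ, E) E (fun X ↦ koszul X Y Z x) x where
  smul {h X} hh hX := by
    simp only [koszul, dirDerivInner_smul₁, dirDerivInner_smul₂ hh hX hY,
      dirDerivInner_comm (X := Y) (Y := Z) (Z := h • X), dirDerivInner_smul₂ hh hX hZ,
      dirDerivInner_comm (X := Y) (Y := Z) (Z := X),
      mlieBracket_smul_left hh hX, mlieBracket_smul_right hh hX, Pi.smul_apply',
      inner_add_left, inner_smul_left, inner_smul_right]
    simp
    ring
  add {X X'} hX hX' := by
    simp only [koszul, dirDerivInner_add₁, dirDerivInner_add₂ hX hX' hY,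
      dirDerivInner_comm (X := Y) (Y := Z) (Z := X + X'), dirDerivInner_add₂ hX hX' hZ,
      dirDerivInner_comm (X := Y) (Y := Z) (Z := X),
      dirDerivInner_comm (X := Y) (Y := Z) (Z := X'),
      mlieBracket_add_left hX hX', mlieBracket_add_right hX hX', Pi.add_apply,
      inner_add_left, inner_add_right]
    ring

theorem koszul_tensorial_right (hX : MDiffAt (T% X) x) (hY : MDiffAt (T% Y) x) :
    TensorialAt 𝓘(ℝ, E) E (fun Z ↦ koszul X Y Z x) x where
  smul {h Z} hh hZ := by
    simp only [koszul, dirDerivInner_smul₁, dirDerivInner_smul₂ hh hZ hX,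
      dirDerivInner_comm (X := X) (Y := Y) (Z := h • Z), dirDerivInner_smul₂ hh hZ hY,
      dirDerivInner_comm (X := X) (Y := Y) (Z := Z),
      mlieBracket_smul_left hh hZ, mlieBracket_smul_right hh hZ, Pi.smul_apply',
      inner_add_left, inner_smul_left, inner_smul_right]
    simp
    rw [real_inner_comm (Y x) (Z x)]
    ring
  add {Z Z'} hZ hZ' := by
    simp only [koszul, dirDerivInner_add₁, dirDerivInner_add₂ hZ hZ' hX,
      dirDerivInner_comm (X := X) (Y := Y) (Z := Z + Z'), dirDerivInner_add₂ hZ hZ' hY,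
      dirDerivInner_comm (X := X) (Y := Y) (Z := Z),
      dirDerivInner_comm (X := X) (Y := Y) (Z := Z'),
      mlieBracket_add_left hZ hZ', mlieBracket_add_right hZ hZ', Pi.add_apply,
      inner_add_left, inner_add_right]
    ring

theorem koszul_add (hX : MDiffAt (T% X) x) (hY : MDiffAt (T% Y) x) (hY' : MDiffAt (T% Y') x)
    (hZ : MDiffAt (T% Z) x) :
    koszul X (Y + Y') Z x = koszul X Y Z x + koszul X Y' Z x := by
  simp only [koszul, dirDerivInner_add₁, dirDerivInner_add₂ hY hY' hZ,
    dirDerivInner_comm (X := Z) (Y := X) (Z := Y + Y'), dirDerivInner_add₂ hY hY' hX,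
    dirDerivInner_comm (X := Z) (Y := X) (Z := Y),
    dirDerivInner_comm (X := Z) (Y := X) (Z := Y'),
    mlieBracket_add_left hY hY', mlieBracket_add_right hY hY', Pi.add_apply,
    inner_add_left, inner_add_right]
  ring

theorem koszul_smul (hh : MDiffAt h x) (hX : MDiffAt (T% X) x) (hY : MDiffAt (T% Y) x)
    (hZ : MDiffAt (T% Z) x) :
    koszul X (h • Y) Z x
      = h x * koszul X Y Z x + mvfderiv 𝓘(ℝ, E) h x (X x) * inner ℝ (Y x) (Z x) := by
  simp only [koszul, dirDerivInner_smul₁, dirDerivInner_smul₂ hh hY hZ,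
    dirDerivInner_comm (X := Z) (Y := X) (Z := h • Y), dirDerivInner_smul₂ hh hY hX,
    dirDerivInner_comm (X := Z) (Y := X) (Z := Y),
    mlieBracket_smul_left hh hY, mlieBracket_smul_right hh hY, Pi.smul_apply',
    inner_add_left, inner_smul_left, inner_smul_right]
  simp
  ring

/-- For `Y` differentiable at `x`, the bilinear form `(u, w) ↦ g(∇_u Y, w)` on the tangent space at
`x`, obtained from the Koszul formula. -/
def koszulForm (Y : Π x : M, TangentSpace 𝓘(ℝ, E) x) (x : M) (hY : MDiffAt (T% Y) x) :
    TangentSpace 𝓘(ℝ, E) x →L[ℝ] TangentSpace 𝓘(ℝ, E) x →L[ℝ] ℝ :=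
  TensorialAt.mkHom₂ (fun X Z ↦ koszul X Y Z x) x
    (fun _ hZ ↦ koszul_tensorial_left hY hZ) (fun _ hX ↦ koszul_tensorial_right hX hY)

theorem koszulForm_apply (hX : MDiffAt (T% X) x) (hY : MDiffAt (T% Y) x) (hZ : MDiffAt (T% Z) x) :
    koszulForm Y x hY (X x) (Z x) = koszul X Y Z x :=
  TensorialAt.mkHom₂_apply (fun _ hZ ↦ koszul_tensorial_left hY hZ)
    (fun _ hX ↦ koszul_tensorial_right hX hY) hX hZ

open Classical in
/-- `∇_u Y`, characterised by `g(∇_u Y, w) = koszulForm Y u w`. -/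
def leviCivitaAux (Y : Π x : M, TangentSpace 𝓘(ℝ, E) x) (x : M) :
    TangentSpace 𝓘(ℝ, E) x →L[ℝ] TangentSpace 𝓘(ℝ, E) x :=
  if hY : MDiffAt (T% Y) x then
    LinearMap.toContinuousLinearMap
      { toFun u := (InnerProductSpace.toDual ℝ (TangentSpace 𝓘(ℝ, E) x)).symm (koszulForm Y x hY u)
        map_add' u v := by simp
        map_smul' c u := by simp }
  else 0

theorem inner_leviCivitaAux (hX : MDiffAt (T% X) x) (hY : MDiffAt (T% Y) x)
    (hZ : MDiffAt (T% Z) x) :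
    inner ℝ (leviCivitaAux Y x (X x)) (Z x) = koszul X Y Z x := by
  rw [← koszulForm_apply hX hY hZ, leviCivitaAux, dif_pos hY]
  exact InnerProductSpace.toDual_symm_apply

/-- The Levi-Civita connection of the Riemannian metric. -/
def leviCivita : CovariantDerivative 𝓘(ℝ, E) E (fun x : M ↦ TangentSpace 𝓘(ℝ, E) x) where
  toFun := leviCivitaAux
  isCovariantDerivativeOnUniv :=
    { add {Y Y' x} hY hY' _ := by
        ext u
        refine ext_inner_right ℝ fun w ↦ ?_
        have hu := FiberBundle.extend_apply_self (F := E) u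
        have hw := FiberBundle.extend_apply_self (F := E) w
        have hdu := FiberBundle.mdifferentiableAt_extend 𝓘(ℝ, E) E u
        have hdw := FiberBundle.mdifferentiableAt_extend 𝓘(ℝ, E) E w
        have hs := mdifferentiableAt_add_section hY hY'
        rw [← hu, ← hw]
        simp only [add_apply, inner_add_left]
        rw [inner_leviCivitaAux hdu hs hdw, inner_leviCivitaAux hdu hY hdw,
          inner_leviCivitaAux hdu hY' hdw, koszul_add hdu hY hY' hdw]
      leibniz {Y h x} hY hh _ := by
        ext u
        refine ext_inner_right ℝ fun w ↦ ?_
        have hu := FiberBundle.extend_apply_self (F := E) u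
        have hw := FiberBundle.extend_apply_self (F := E) w
        have hdu := FiberBundle.mdifferentiableAt_extend 𝓘(ℝ, E) E u
        have hdw := FiberBundle.mdifferentiableAt_extend 𝓘(ℝ, E) E w
        have hs := hh.smul_section hY
        rw [← hu, ← hw]
        simp only [add_apply, inner_add_left, smul_apply,
          ContinuousLinearMap.smulRight_apply, real_inner_smul_left]
        rw [inner_leviCivitaAux hdu hs hdw, inner_leviCivitaAux hdu hY hdw,
          koszul_smul hh hdu hY hdw] }

theorem inner_leviCivita (hX : MDiffAt (T% X) x) (hY : MDiffAt (T% Y) x)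
    (hZ : MDiffAt (T% Z) x) :
    inner ℝ (leviCivita Y x (X x)) (Z x) = koszul X Y Z x :=
  inner_leviCivitaAux hX hY hZ

/-- The Levi-Civita connection is compatible with the metric. -/
theorem leviCivita_metric (hX : MDiffAt (T% X) x) (hY : MDiffAt (T% Y) x)
    (hZ : MDiffAt (T% Z) x) :
    mvfderiv 𝓘(ℝ, E) (fun y : M ↦ inner ℝ (Y y) (Z y)) x (X x)
      = inner ℝ (leviCivita Y x (X x)) (Z x) + inner ℝ (Y x) (leviCivita Z x (X x)) := by
  rw [real_inner_comm _ (Y x), inner_leviCivita hX hY hZ, inner_leviCivita hX hZ hY]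
  change dirDerivInner X Y Z x = _
  rw [koszul, koszul, mlieBracket_swap_apply (V := X) (W := Z),
    mlieBracket_swap_apply (V := Y) (W := Z), mlieBracket_swap_apply (V := X) (W := Y),
    dirDerivInner_comm (X := X) (Y := Z), dirDerivInner_comm (X := Y) (Y := Z),
    dirDerivInner_comm (X := Z) (Y := X)]
  simp only [inner_neg_left]
  ring

/-- The Levi-Civita connection is torsion-free. -/
theorem leviCivita_torsion :
    (leviCivita (E := E) (M := M)).torsion = 0 := by
  rw [CovariantDerivative.torsion_eq_zero_iff]
  intro X Y x hX hY
  refine ext_inner_right ℝ fun w ↦ ?_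
  have hw := FiberBundle.extend_apply_self (F := E) w
  have hdw := FiberBundle.mdifferentiableAt_extend 𝓘(ℝ, E) E w
  rw [← hw, inner_sub_left, inner_leviCivita hX hY hdw, inner_leviCivita hY hX hdw]
  generalize FiberBundle.extend E w = Z
  rw [koszul, koszul, mlieBracket_swap_apply (V := Y) (W := X),
    mlieBracket_swap_apply (V := Z) (W := X),
    mlieBracket_swap_apply (V := Z) (W := Y),
    dirDerivInner_comm (X := X) (Y := Z), dirDerivInner_comm (X := Y) (Y := Z),
    dirDerivInner_comm (X := Z) (Y := X)]
  simp only [inner_neg_left]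
  ring

/-- The curvature `R_{X,Y} Z = ∇_X ∇_Y Z - ∇_Y ∇_X Z - ∇_{[X,Y]} Z` on vector fields. -/
def curvature (X Y Z : Π x : M, TangentSpace 𝓘(ℝ, E) x) (x : M) : TangentSpace 𝓘(ℝ, E) x :=
  leviCivita (fun y ↦ leviCivita Z y (Y y)) x (X x)
    - leviCivita (fun y ↦ leviCivita Z y (X y)) x (Y x)
    - leviCivita Z x (mlieBracket 𝓘(ℝ, E) X Y x)

/-- The curvature tensor at `x`, evaluated on tangent vectors through extensions of them to vector
fields that are smooth near `x` (by tensoriality the choice of the extensions is immaterial). -/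
def curvatureAt (x : M) (u v w : TangentSpace 𝓘(ℝ, E) x) : TangentSpace 𝓘(ℝ, E) x :=
  curvature (FiberBundle.extend E u) (FiberBundle.extend E v) (FiberBundle.extend E w) x

/-- The Lie derivative of the metric:
`(𝓛_V g)(X, Y) = V (g(X, Y)) - g([V, X], Y) - g(X, [V, Y])`. -/
def lieDerivMetric (V X Y : Π x : M, TangentSpace 𝓘(ℝ, E) x) (x : M) : ℝ :=
  dirDerivInner V X Y x - inner ℝ (mlieBracket 𝓘(ℝ, E) V X x) (Y x)
    - inner ℝ (X x) (mlieBracket 𝓘(ℝ, E) V Y x)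

variable (E M) in
/-- A weak metric `f`-structure `(f, Q, ξ_i, η^i, g)` on a manifold of dimension `2n + s` with
Riemannian metric `g`. -/
structure WeakMetricFStructure (n s : ℕ) where
  f : Π x : M, TangentSpace 𝓘(ℝ, E) x →L[ℝ] TangentSpace 𝓘(ℝ, E) x
  Q : Π x : M, TangentSpace 𝓘(ℝ, E) x →L[ℝ] TangentSpace 𝓘(ℝ, E) x
  ξ : Fin s → Π x : M, TangentSpace 𝓘(ℝ, E) x
  η : Fin s → Π x : M, TangentSpace 𝓘(ℝ, E) x →L[ℝ] ℝ
  dim_eq : Module.finrank ℝ E = 2 * n + s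
  contMDiff_f : ContMDiff 𝓘(ℝ, E) (𝓘(ℝ, E).prod 𝓘(ℝ, E →L[ℝ] E)) ∞
    (fun x ↦ (⟨x, f x⟩ : TotalSpace (E →L[ℝ] E)
      (fun x : M ↦ TangentSpace 𝓘(ℝ, E) x →L[ℝ] TangentSpace 𝓘(ℝ, E) x)))
  contMDiff_Q : ContMDiff 𝓘(ℝ, E) (𝓘(ℝ, E).prod 𝓘(ℝ, E →L[ℝ] E)) ∞
    (fun x ↦ (⟨x, Q x⟩ : TotalSpace (E →L[ℝ] E)
      (fun x : M ↦ TangentSpace 𝓘(ℝ, E) x →L[ℝ] TangentSpace 𝓘(ℝ, E) x)))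
  contMDiff_ξ : ∀ i, CMDiff ∞ (T% (ξ i))
  contMDiff_η : ∀ i, ContMDiff 𝓘(ℝ, E) (𝓘(ℝ, E).prod 𝓘(ℝ, E →L[ℝ] ℝ)) ∞
    (fun x ↦ (⟨x, η i x⟩ : TotalSpace (E →L[ℝ] ℝ)
      (fun x : M ↦ TangentSpace 𝓘(ℝ, E) x →L[ℝ] Bundle.Trivial M ℝ x)))
  f_skew : ∀ x u v, inner ℝ (f x u) v = - inner ℝ u (f x v)
  f_rank : ∀ x, Module.finrank ℝ (LinearMap.range (f x).toLinearMap) = 2 * n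
  Q_selfAdjoint : ∀ x u v, inner ℝ (Q x u) v = inner ℝ u (Q x v)
  Q_nonsingular : ∀ x, Function.Bijective (Q x)
  ξ_orthonormal : ∀ x, Orthonormal ℝ (fun i ↦ ξ i x)
  η_ξ : ∀ x i j, η i x (ξ j x) = if i = j then 1 else 0
  f_sq : ∀ x u, f x (f x u) = - Q x u + ∑ i, η i x u • ξ i x
  Q_ξ : ∀ x i, Q x (ξ i x) = ξ i x
  inner_f_f : ∀ x u v, inner ℝ (f x u) (f x v) = inner ℝ u (Q x v) - ∑ i, η i x u * η i x v

namespace WeakMetricFStructure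

variable {n s : ℕ} (S : WeakMetricFStructure E M n s)

/-- The vector field `ξ_1 + ⋯ + ξ_s`. -/
def ξbar (x : M) : TangentSpace 𝓘(ℝ, E) x := ∑ i, S.ξ i x

/-- The 1-form `η^1 + ⋯ + η^s`. -/
def ηbar (x : M) (u : TangentSpace 𝓘(ℝ, E) x) : ℝ := ∑ i, S.η i x u

/-- The covariant derivative `(∇_X f) Y = ∇_X (f Y) - f (∇_X Y)`. -/
def covDerivF (X Y : Π x : M, TangentSpace 𝓘(ℝ, E) x) (x : M) : TangentSpace 𝓘(ℝ, E) x :=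
  leviCivita (fun y ↦ S.f y (Y y)) x (X x) - S.f x (leviCivita Y x (X x))

/-- A weak `βf`-Kenmotsu structure:
`(∇_X f) Y = β {g(f X, Y) (ξ_1 + ⋯ + ξ_s) - (η^1 + ⋯ + η^s)(Y) f X}`. -/
def IsWeakKenmotsu (β : M → ℝ) : Prop :=
  CMDiff ∞ β ∧
  ∀ (X Y : Π x : M, TangentSpace 𝓘(ℝ, E) x) (x : M), CMDiffAt ∞ (T% X) x → CMDiffAt ∞ (T% Y) x →
    S.covDerivF X Y x =
      β x • ((inner ℝ (S.f x (X x)) (Y x) : ℝ) • S.ξbar x - S.ηbar x (Y x) • S.f x (X x))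

/-- The `*`-Ricci tensor `Ric^*(u, v) = (1/2) trace {w ↦ f (R_{u, f v} w)}`, the trace being
computed in an orthonormal basis of the tangent space. -/
def starRicci (x : M) (u v : TangentSpace 𝓘(ℝ, E) x) : ℝ :=
  (1 / 2 : ℝ) * ∑ i, inner ℝ (stdOrthonormalBasis ℝ (TangentSpace 𝓘(ℝ, E) x) i)
    (S.f x (curvatureAt x u (S.f x v) (stdOrthonormalBasis ℝ (TangentSpace 𝓘(ℝ, E) x) i)))

/-- `(g, V)` is a `*`-`η`-Ricci soliton with soliton constants `lam`, `mu`: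
`(1/2) 𝓛_V g + Ric^* = lam {g - ∑ η^i ⊗ η^i} + (lam + mu) (∑ η^i) ⊗ (∑ η^i)`. -/
def IsStarEtaRicciSoliton (V : Π x : M, TangentSpace 𝓘(ℝ, E) x) (lam mu : ℝ) : Prop :=
  CMDiff ∞ (T% V) ∧
  ∀ (X Y : Π x : M, TangentSpace 𝓘(ℝ, E) x) (x : M), CMDiffAt ∞ (T% X) x → CMDiffAt ∞ (T% Y) x →
    (1 / 2 : ℝ) * lieDerivMetric V X Y x + S.starRicci x (X x) (Y x) =
      lam * (inner ℝ (X x) (Y x) - ∑ i, S.η i x (X x) * S.η i x (Y x))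
        + (lam + mu) * (S.ηbar x (X x) * S.ηbar x (Y x))

/-- `(g, V)` is a `*`-Ricci soliton with soliton constant `lam`: the case `mu = 0`. -/
def IsStarRicciSoliton (V : Π x : M, TangentSpace 𝓘(ℝ, E) x) (lam : ℝ) : Prop :=
  S.IsStarEtaRicciSoliton V lam 0

end WeakMetricFStructure

end WeakKenmotsu

end

/-! The claim is local, so it is proved by computing over the ring of smooth functions on an open
set that carries an orthonormal frame and a nowhere zero horizontal field (horizontal: orthogonal to
all ξ_i). Write ζ for ξ_1 + ⋯ + ξ_s, φ = g(V, ζ), and ρ(X, Y) = tr(f R(X, Y)), so that ρ(X, fY) = 2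
Ric*(X, Y).

The structure equation determines ∇ξ_i only up to components along the ξ_j. The other terms of the
soliton equation are symmetric, hence so is Ric*, and this forces ∇_Y ζ = sβY for horizontal Y
(`Soliton.nabZeta`). Independently, ∇_ζ ζ = 0 by the pair symmetry of R (`nab_ζ_ζ`).

Let D be the covariant derivative along ζ of 2-tensors on horizontal fields. Then Dg = 0 and Df = 0,
and three identities hold. (1) The second Bianchi identity gives (D + 2sβ) ρ(·, f·) = 4s²β³ g(·,
f²·) (`NabZeta.d_ρ`). (2) Applying D to the horizontal soliton equation gives Hess φ + sβ ρ(·, f·) =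
2s²βλ g + 2s²β³ g(·, f²·) (`Soliton.hess`). (3) Since ζφ = s²λ is constant, (D + 2sβ) Hess φ =
2s³β²λ g (inside `Soliton.eq_zero`). Apply D + 2sβ to (2): the terms in f² cancel and 2s³β²λ g =
4s³β²λ g remains, so λ = 0. No explicit formula for Ric* is needed. -/

/-! ### Riemannian calculus over a commutative ring of functions. -/

/-- The algebra of vector fields (`𝔛`) and functions (`A`) on a Riemannian manifold admitting an
orthonormal frame `e`: the derivative `d` of functions, the metric `g`, and its torsion-free metric
connection `nab`. -/
structure FramedConnection (A 𝔛 ι : Type*) [CommRing A] [AddCommGroup 𝔛] [Module A 𝔛]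
    [Fintype ι] where
  d : 𝔛 →ₗ[A] A →+ A
  d_mul : ∀ X a b, d X (a * b) = a * d X b + b * d X a
  g : 𝔛 →ₗ[A] 𝔛 →ₗ[A] A
  g_symm : ∀ X Y, g X Y = g Y X
  nab : 𝔛 →ₗ[A] 𝔛 →+ 𝔛
  nab_smul : ∀ X (a : A) Y, nab X (a • Y) = a • nab X Y + d X a • Y
  d_g : ∀ X Y Z, d X (g Y Z) = g (nab X Y) Z + g Y (nab X Z)
  /-- the Jacobi identity for the bracket `∇_X Y - ∇_Y X` -/
  jacobi : ∀ X Y Z, nab X (nab Y Z - nab Z Y) - nab (nab Y Z - nab Z Y) X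
    = (nab (nab X Y - nab Y X) Z - nab Z (nab X Y - nab Y X))
      + (nab Y (nab X Z - nab Z X) - nab (nab X Z - nab Z X) Y)
  e : ι → 𝔛
  sum_g_smul_e : ∀ X, ∑ i, g X (e i) • e i = X
  d_g_e : ∀ X i j, d X (g (e i) (e j)) = 0
  smul_left_cancel : ∀ a : A, (∀ X : 𝔛, a • X = 0) → a = 0
  two_cancel : ∀ a : A, 2 * a = 0 → a = 0

namespace FramedConnection

variable {A 𝔛 ι : Type*} [CommRing A] [AddCommGroup 𝔛] [Module A 𝔛] [Fintype ι]
  (C : FramedConnection A 𝔛 ι)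

/-- The Lie bracket. -/
def br (X Y : 𝔛) : 𝔛 := C.nab X Y - C.nab Y X

theorem br_smul (X : 𝔛) (a : A) (Y : 𝔛) : C.br X (a • Y) = a • C.br X Y + C.d X a • Y := by
  simp only [br, C.nab_smul, map_smul, AddMonoidHom.smul_apply]
  module

theorem br_add (X Y Z : 𝔛) : C.br X (Y + Z) = C.br X Y + C.br X Z := by
  simp only [br, map_add, AddMonoidHom.add_apply]
  abel

theorem br_jacobi (X Y Z : 𝔛) :
    C.br X (C.br Y Z) = C.br (C.br X Y) Z + C.br Y (C.br X Z) :=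
  C.jacobi X Y Z

/-- Expanding the Jacobi identity for X, Y, aZ by the Leibniz rule leaves exactly this identity as
the coefficient of Z. It therefore need not be an axiom. -/
theorem d_br (X Y : 𝔛) (a : A) : C.d (C.br X Y) a = C.d X (C.d Y a) - C.d Y (C.d X a) := by
  rw [← sub_eq_zero]
  refine C.smul_left_cancel _ fun Z ↦ ?_
  have h := C.br_jacobi X Y (a • Z)
  simp only [br_smul, br_add] at h
  rw [C.br_jacobi X Y Z] at h
  linear_combination (norm := module) -h

theorem g_ext {X Y : 𝔛} (h : ∀ Z, C.g X Z = C.g Y Z) : X = Y := by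
  rw [← C.sum_g_smul_e X, ← C.sum_g_smul_e Y]
  simp only [h]

/-- The curvature operator. -/
def R (X Y : 𝔛) : 𝔛 →+ 𝔛 :=
  (C.nab X).comp (C.nab Y) - (C.nab Y).comp (C.nab X) - C.nab (C.br X Y)

theorem R_apply (X Y Z : 𝔛) :
    C.R X Y Z = C.nab X (C.nab Y Z) - C.nab Y (C.nab X Z) - C.nab (C.br X Y) Z := rfl

theorem R_smul (X Y : 𝔛) (a : A) (Z : 𝔛) : C.R X Y (a • Z) = a • C.R X Y Z := by
  simp only [R_apply, C.nab_smul, map_add, C.d_br]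
  module

theorem R_swap (X Y Z : 𝔛) : C.R X Y Z = - C.R Y X Z := by
  simp only [R_apply, br, map_sub, AddMonoidHom.sub_apply]
  abel

theorem R_smul_left (a : A) (X Y Z : 𝔛) : C.R (a • X) Y Z = a • C.R X Y Z := by
  simp only [R_apply, br, map_sub, AddMonoidHom.sub_apply, map_smul, AddMonoidHom.smul_apply,
    C.nab_smul, map_add, AddMonoidHom.add_apply]
  module

theorem R_add_left (X X' Y Z : 𝔛) : C.R (X + X') Y Z = C.R X Y Z + C.R X' Y Z := by
  simp only [R_apply, br, map_sub, AddMonoidHom.sub_apply, map_add, AddMonoidHom.add_apply]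
  abel

/-- The curvature operator as a linear map in all arguments. -/
def Rₗ : 𝔛 →ₗ[A] 𝔛 →ₗ[A] 𝔛 →ₗ[A] 𝔛 :=
  LinearMap.mk₂ A (fun X Y ↦ { toFun := C.R X Y, map_add' := map_add _, map_smul' := C.R_smul X Y })
    (fun _ _ _ ↦ LinearMap.ext fun _ ↦ C.R_add_left _ _ _ _)
    (fun _ _ _ ↦ LinearMap.ext fun _ ↦ C.R_smul_left _ _ _ _)
    (fun X Y Y' ↦ LinearMap.ext fun Z ↦ by
      change C.R X (Y + Y') Z = C.R X Y Z + C.R X Y' Z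
      rw [C.R_swap X, C.R_add_left, C.R_swap X, C.R_swap X]; abel)
    (fun a X Y ↦ LinearMap.ext fun Z ↦ by
      change C.R X (a • Y) Z = a • C.R X Y Z
      rw [C.R_swap X, C.R_smul_left, C.R_swap X]; simp)

theorem Rₗ_apply (X Y Z : 𝔛) : C.Rₗ X Y Z = C.R X Y Z := rfl

theorem bianchi (X Y Z : 𝔛) : C.R X Y Z + C.R Y Z X + C.R Z X Y = 0 := by
  have h := C.br_jacobi X Y Z
  simp only [R_apply, br, map_sub, AddMonoidHom.sub_apply] at h ⊢
  linear_combination (norm := module) h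

theorem g_R_swap (X Y Z W : 𝔛) : C.g (C.R X Y Z) W = - C.g Z (C.R X Y W) := by
  have h := C.d_br X Y (C.g Z W)
  simp only [C.d_g, map_add] at h
  simp only [R_apply, map_sub, LinearMap.sub_apply]
  linear_combination -h

/-- The usual octahedron argument: a signed sum of four first Bianchi identities is twice the
difference of the two sides, modulo the skew-symmetries. -/
theorem g_R_pair (X Y Z W : 𝔛) : C.g (C.R X Y Z) W = C.g (C.R Z W X) Y := by
  have b (X Y Z W : 𝔛) :
      C.g (C.R X Y Z) W + C.g (C.R Y Z X) W + C.g (C.R Z X Y) W = 0 := by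
    rw [← LinearMap.add_apply, ← LinearMap.add_apply, ← map_add, ← map_add, C.bianchi]; simp
  have s (X Y Z W : 𝔛) : C.g (C.R X Y Z) W = - C.g (C.R Y X Z) W := by
    rw [C.R_swap]; simp
  have t (X Y Z W : 𝔛) : C.g (C.R X Y Z) W = - C.g (C.R X Y W) Z := by
    rw [C.g_R_swap, C.g_symm]
  rw [← sub_eq_zero]
  apply C.two_cancel
  linear_combination b X Y Z W + b Y Z W X - b Z W X Y - b W X Y Z - t Y Z W X - t Z W Y X
    + t W X Z Y + t X Y W Z + s X Z W Y - t Z X W Y + s Y W X Z - t W Y X Z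

/-- The second Bianchi identity, as an identity between commutators of operators. -/
theorem bianchi_second (X Y Z W : 𝔛) :
    (C.nab X (C.R Y Z W) - C.R Y Z (C.nab X W)) + (C.nab Y (C.R Z X W) - C.R Z X (C.nab Y W))
      + (C.nab Z (C.R X Y W) - C.R X Y (C.nab Z W))
    = C.R (C.br X Y) Z W + C.R (C.br Y Z) X W + C.R (C.br Z X) Y W := by
  have h : C.nab (C.br (C.br X Y) Z) W + C.nab (C.br (C.br Y Z) X) W
      + C.nab (C.br (C.br Z X) Y) W = 0 := by
    have := C.br_jacobi X Y Z
    have h' : C.br (C.br X Y) Z + C.br (C.br Y Z) X + C.br (C.br Z X) Y = 0 := by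
      simp only [br, map_sub, AddMonoidHom.sub_apply] at this ⊢
      linear_combination (norm := module) -this
    rw [← AddMonoidHom.add_apply, ← AddMonoidHom.add_apply, ← map_add, ← map_add, h']
    simp
  simp only [R_apply, map_sub]
  linear_combination (norm := module) h

/-- The trace of an endomorphism. -/
def tr (T : 𝔛 → 𝔛) : A := ∑ i, C.g (C.e i) (T (C.e i))

theorem sum_g_mul_g (X Y : 𝔛) : ∑ i, C.g X (C.e i) * C.g Y (C.e i) = C.g X Y := by
  conv_rhs => rw [← C.sum_g_smul_e Y]
  simp [mul_comm]

/-- In an orthonormal frame the connection coefficients are skew-symmetric (`h`), so the terms in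
which the frame itself is differentiated cancel in pairs (`h₃`). -/
theorem d_tr (X : 𝔛) (T : 𝔛 →ₗ[A] 𝔛) :
    C.d X (C.tr T) = C.tr (fun Y ↦ C.nab X (T Y) - T (C.nab X Y)) := by
  have h (i j) : C.g (C.nab X (C.e i)) (C.e j) = - C.g (C.nab X (C.e j)) (C.e i) := by
    have := C.d_g_e X i j
    rw [C.d_g, C.g_symm (C.e i)] at this
    linear_combination this
  have h₁ (i) : C.g (C.nab X (C.e i)) (T (C.e i))
      = ∑ j, C.g (C.nab X (C.e i)) (C.e j) * C.g (C.e j) (T (C.e i)) := by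
    rw [← C.sum_g_mul_g]
    exact Finset.sum_congr rfl fun j _ ↦ by rw [C.g_symm (T _)]
  have h₂ (i) : C.g (C.e i) (T (C.nab X (C.e i)))
      = ∑ j, C.g (C.nab X (C.e i)) (C.e j) * C.g (C.e i) (T (C.e j)) := by
    conv_lhs => rw [← C.sum_g_smul_e (C.nab X (C.e i))]
    simp
  have h₃ : ∑ i, C.g (C.nab X (C.e i)) (T (C.e i)) + ∑ i, C.g (C.e i) (T (C.nab X (C.e i)))
      = 0 := by
    simp only [h₁, h₂]
    rw [Finset.sum_comm, ← Finset.sum_add_distrib]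
    refine Finset.sum_eq_zero fun i _ ↦ ?_
    rw [← Finset.sum_add_distrib]
    refine Finset.sum_eq_zero fun j _ ↦ ?_
    rw [h j i]; ring
  simp only [tr, map_sum, C.d_g, map_sub, Finset.sum_sub_distrib, Finset.sum_add_distrib]
  linear_combination h₃

end FramedConnection

/-! ### Weak Kenmotsu structures: the connection and curvature on characteristic fields. -/

namespace FramedConnection

variable {A 𝔛 ι : Type*} [CommRing A] [AddCommGroup 𝔛] [Module A 𝔛] [Fintype ι]

/-- A weak `bf`-Kenmotsu structure, `b` a constant, in terms of vector fields. -/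
structure Kenmotsu (C : FramedConnection A 𝔛 ι) (s : ℕ) where
  f : 𝔛 →ₗ[A] 𝔛
  ξ : Fin s → 𝔛
  b : A
  d_b : ∀ X, C.d X b = 0
  b_cancel : ∀ a, b * a = 0 → a = 0
  f_skew : ∀ X Y, C.g (f X) Y = - C.g X (f Y)
  g_ξ : ∀ i j, C.g (ξ i) (ξ j) = if i = j then 1 else 0
  f_ξ : ∀ i, f (ξ i) = 0
  eq_of_f_f : ∀ X, f (f X) = 0 → X = ∑ i, C.g X (ξ i) • ξ i
  nab_f : ∀ X Y, C.nab X (f Y) - f (C.nab X Y)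
    = b • (C.g (f X) Y • ∑ i, ξ i - C.g Y (∑ i, ξ i) • f X)
  /-- a nowhere vanishing horizontal vector field -/
  X₀ : 𝔛
  g_X₀_ξ : ∀ i, C.g X₀ (ξ i) = 0
  X₀_cancel : ∀ a, C.g X₀ X₀ * a = 0 → a = 0

namespace Kenmotsu

variable {C : FramedConnection A 𝔛 ι} {s : ℕ} (K : C.Kenmotsu s)

/-- The sum of the characteristic vector fields. -/
def ζ : 𝔛 := ∑ i, K.ξ i

/-- Orthogonality to the characteristic vector fields. -/
def Hor (Y : 𝔛) : Prop := ∀ i, C.g Y (K.ξ i) = 0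

/-- The horizontal projection. -/
def P (X : 𝔛) : 𝔛 := X - ∑ i, C.g X (K.ξ i) • K.ξ i

theorem g_ξ_ζ (i : Fin s) : C.g (K.ξ i) K.ζ = 1 := by
  simp [ζ, K.g_ξ]

theorem g_ζ_ζ : C.g K.ζ K.ζ = s := by
  nth_rw 1 [ζ]
  simp [LinearMap.sum_apply, K.g_ξ_ζ]

theorem f_ζ : K.f K.ζ = 0 := by simp [ζ, K.f_ξ]

theorem hor_P (X : 𝔛) : K.Hor (K.P X) := by
  intro i
  simp [P, LinearMap.sum_apply, K.g_ξ]

theorem hor_f (X : 𝔛) : K.Hor (K.f X) := by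
  intro i
  simp [K.f_skew, K.f_ξ]

variable {K} in
theorem Hor.g_ζ {Y : 𝔛} (h : K.Hor Y) : C.g Y K.ζ = 0 := by
  simp [ζ, h _]

variable {K} in
theorem Hor.ζ_g {Y : 𝔛} (h : K.Hor Y) : C.g K.ζ Y = 0 := by
  rw [C.g_symm, h.g_ζ]

/-- A vector field is determined by its products with horizontal and characteristic fields. -/
theorem ext_hor {X Y : 𝔛} (h : ∀ Z, K.Hor Z → C.g X Z = C.g Y Z)
    (h' : ∀ i, C.g X (K.ξ i) = C.g Y (K.ξ i)) : X = Y := by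
  refine C.g_ext fun Z ↦ ?_
  have hZ : Z = K.P Z + ∑ i, C.g Z (K.ξ i) • K.ξ i := by simp [P]
  rw [hZ, map_add, map_add, h _ (K.hor_P Z)]
  simp [h']

theorem nab_f_apply (X Y : 𝔛) : C.nab X (K.f Y)
    = K.f (C.nab X Y) + K.b • (C.g (K.f X) Y • K.ζ - C.g Y K.ζ • K.f X) := by
  rw [ζ, ← K.nab_f]; abel

theorem nab_ζ_f (Y : 𝔛) : C.nab K.ζ (K.f Y) = K.f (C.nab K.ζ Y) := by
  rw [nab_f_apply, f_ζ]; simp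

variable {K} in
-- The structure equation on ξ_i reads f(∇_X ξ_i - bX) = 0, so that difference is a combination of
-- the ξ_j. The components of ∇_X ξ_i along the ξ_j stay undetermined here.
theorem Hor.g_nab_ξ {Y : 𝔛} (h : K.Hor Y) (X : 𝔛) (i : Fin s) :
    C.g (C.nab X (K.ξ i)) Y = K.b * C.g X Y := by
  have h₁ := K.nab_f_apply X (K.ξ i)
  rw [K.f_ξ, map_zero, K.g_ξ_ζ, K.f_skew, K.f_ξ] at h₁
  have h₂ : K.f (K.f (C.nab X (K.ξ i) - K.b • X)) = 0 := by
    have : K.f (C.nab X (K.ξ i) - K.b • X) = 0 := by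
      simp only [map_zero, neg_zero, zero_smul, one_smul, zero_sub] at h₁
      rw [map_sub, map_smul, h₁]
      module
    rw [this, map_zero]
  have h₃ := congr(C.g Y $(K.eq_of_f_f _ h₂))
  simp only [map_sum, map_smul, h _, map_sub] at h₃
  rw [C.g_symm, C.g_symm X]
  simpa [sub_eq_zero] using h₃

variable {K} in
theorem Hor.g_nab_ζ {Y : 𝔛} (h : K.Hor Y) (X : 𝔛) :
    C.g (C.nab X K.ζ) Y = s * K.b * C.g X Y := by
  simp [ζ, LinearMap.sum_apply, h.g_nab_ξ, mul_assoc]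

/-- The squared length of ζ is the constant s. -/
theorem g_nab_ζ_ζ (X : 𝔛) : C.g (C.nab X K.ζ) K.ζ = 0 := by
  have h := C.d_g X K.ζ K.ζ
  have h₀ (n : ℕ) : C.d X (n : A) = 0 := by
    have h₁ : C.d X 1 = 0 := by simpa using C.d_mul X 1 1
    rw [← nsmul_one, map_nsmul, h₁, smul_zero]
  rw [g_ζ_ζ, h₀, C.g_symm K.ζ] at h
  exact C.two_cancel _ (by linear_combination -h)

variable {K} in
theorem Hor.g_nab {Y : 𝔛} (h : K.Hor Y) (X : 𝔛) (i : Fin s) :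
    C.g (C.nab X Y) (K.ξ i) = - (K.b * C.g X Y) := by
  have h' := C.d_g X Y (K.ξ i)
  rw [h i, map_zero, C.g_symm Y, h.g_nab_ξ] at h'
  linear_combination -h'

variable {K} in
/-- The decomposition of `∇_X Y` for horizontal `Y`. -/
theorem Hor.nab_eq {Y : 𝔛} (h : K.Hor Y) (X : 𝔛) :
    C.nab X Y = K.P (C.nab X Y) - (K.b * C.g X Y) • K.ζ := by
  simp [P, h.g_nab, ζ, Finset.smul_sum]

theorem d_ξ (X : 𝔛) (i j : Fin s) :
    C.g (C.nab X (K.ξ i)) (K.ξ j) = - C.g (C.nab X (K.ξ j)) (K.ξ i) := by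
  have h := C.d_g X (K.ξ i) (K.ξ j)
  have h₁ : C.d X 1 = 0 := by simpa using C.d_mul X 1 1
  rw [K.g_ξ, C.g_symm (K.ξ i)] at h
  split_ifs at h <;> simp only [h₁, map_zero] at h <;> linear_combination -h

theorem g_nab_ξ_ζ (X : 𝔛) (i : Fin s) :
    C.g (C.nab X (K.ξ i)) K.ζ = - C.g (C.nab X K.ζ) (K.ξ i) := by
  simp only [ζ, map_sum, LinearMap.sum_apply, ← Finset.sum_neg_distrib]
  exact Finset.sum_congr rfl fun j _ ↦ K.d_ξ X i j

/-- The function `σ_i` in the formula for the horizontal part of `R(X, Y) ξ_i`. -/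
def σ (i : Fin s) : 𝔛 →ₗ[A] A where
  toFun X := K.b * C.g (C.nab X (K.ξ i)) K.ζ - K.b ^ 2 * C.g X K.ζ
  map_add' X Y := by
    simp only [map_add, AddMonoidHom.add_apply, LinearMap.add_apply]; ring
  map_smul' a X := by
    simp only [map_smul, AddMonoidHom.smul_apply, LinearMap.smul_apply, smul_eq_mul,
      RingHom.id_apply]
    ring

theorem σ_apply (i : Fin s) (X : 𝔛) :
    K.σ i X = K.b * C.g (C.nab X (K.ξ i)) K.ζ - K.b ^ 2 * C.g X K.ζ := rfl

variable {K} in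
-- Differentiate g(∇_Z ξ_i, Y) = b g(Z, Y) along X. The part of ∇_X Y along ζ is -b g(X, Y) ζ, which
-- produces both terms of `σ`; antisymmetrising in X, Z removes the rest.
theorem Hor.g_R_ξ {Y : 𝔛} (h : K.Hor Y) (X Z : 𝔛) (i : Fin s) :
    C.g (C.R X Z (K.ξ i)) Y = C.g X Y * K.σ i Z - C.g Z Y * K.σ i X := by
  have key (X Z : 𝔛) : C.g (C.nab X (C.nab Z (K.ξ i))) Y
      = K.b * C.g (C.nab X Z) Y + C.g X Y * K.σ i Z := by
    have h₁ := C.d_g X (C.nab Z (K.ξ i)) Y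
    rw [h.g_nab_ξ, C.d_mul, K.d_b, C.d_g, h.nab_eq X] at h₁
    simp only [map_sub, map_smul, smul_eq_mul, (K.hor_P _).g_nab_ξ] at h₁
    simp only [σ_apply]
    linear_combination -h₁
  simp only [C.R_apply, br, map_sub, LinearMap.sub_apply, AddMonoidHom.sub_apply, key, h.g_nab_ξ]
  ring

variable {K} in
-- Summing `Hor.g_R_ξ` over i removes the undetermined components, because their sum is g(∇_X ζ, ζ)
-- = 0.
theorem Hor.g_R_ζ {Y : 𝔛} (h : K.Hor Y) (X Z : 𝔛) :
    C.g (C.R X Z K.ζ) Y = s * K.b ^ 2 * (C.g Z Y * C.g X K.ζ - C.g X Y * C.g Z K.ζ) := by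
  have hσ (X) : ∑ i, K.σ i X = - (s * K.b ^ 2 * C.g X K.ζ) := by
    have : ∑ i, C.g (C.nab X (K.ξ i)) K.ζ = 0 := by
      have h' : C.nab X K.ζ = ∑ i, C.nab X (K.ξ i) := by simp [ζ]
      rw [← K.g_nab_ζ_ζ X, h', map_sum, LinearMap.sum_apply]
    simp only [σ_apply, Finset.sum_sub_distrib, ← Finset.mul_sum, this]
    simp
    ring
  have : C.g (C.R X Z K.ζ) Y = ∑ i, C.g (C.R X Z (K.ξ i)) Y := by
    simp [ζ, LinearMap.sum_apply]
  rw [this]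
  simp only [h.g_R_ξ, Finset.sum_sub_distrib, ← Finset.mul_sum, hσ]
  ring

/-- Pair symmetry of R on X₀, ξ_j, ξ_i, X₀; the factor g(X₀, X₀) is then cancelled. -/
theorem σ_ξ_comm (i j : Fin s) : K.σ i (K.ξ j) = K.σ j (K.ξ i) := by
  have h : K.Hor K.X₀ := K.g_X₀_ξ
  have h₁ (i j) : C.g (C.R K.X₀ (K.ξ j) (K.ξ i)) K.X₀ = C.g K.X₀ K.X₀ * K.σ i (K.ξ j) := by
    rw [h.g_R_ξ, C.g_symm (K.ξ j), h j]; ring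
  rw [← sub_eq_zero]
  refine K.X₀_cancel _ ?_
  rw [mul_sub, ← h₁, ← h₁ j i, sub_eq_zero, C.g_R_pair, C.R_swap, map_neg,
    LinearMap.neg_apply, C.g_R_swap, neg_neg, C.g_symm]

/-- By `σ_ξ_comm`, g(∇_{ξ_j} ξ_i, ζ) is symmetric in i and j. Summing over j turns g(∇_ζ ξ_i, ζ)
into g(∇_{ξ_i} ζ, ζ) = 0. -/
theorem nab_ζ_ζ : C.nab K.ζ K.ζ = 0 := by
  refine K.ext_hor (fun Z hZ ↦ ?_) fun i ↦ ?_
  · rw [hZ.g_nab_ζ, hZ.ζ_g]; simp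
  · have h (j) : C.g (C.nab (K.ξ j) (K.ξ i)) K.ζ = C.g (C.nab (K.ξ i) (K.ξ j)) K.ζ := by
      have h := K.σ_ξ_comm i j
      simp only [σ_apply, K.g_ξ_ζ] at h
      rw [← sub_eq_zero]
      exact K.b_cancel _ (by linear_combination h)
    have h' : C.g (C.nab K.ζ (K.ξ i)) K.ζ = C.g (C.nab (K.ξ i) K.ζ) K.ζ := by
      have e₁ : C.nab K.ζ (K.ξ i) = ∑ j, C.nab (K.ξ j) (K.ξ i) := by
        rw [ζ, map_sum, AddMonoidHom.finsetSum_apply]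
      have e₂ : C.nab (K.ξ i) K.ζ = ∑ j, C.nab (K.ξ i) (K.ξ j) := by
        rw [ζ, map_sum]
      rw [e₁, e₂]
      simp only [map_sum, LinearMap.sum_apply, h]
    rw [← neg_neg (C.g (C.nab K.ζ K.ζ) (K.ξ i)), ← K.g_nab_ξ_ζ, h', K.g_nab_ζ_ζ]
    simp

/-! ### The trace form ρ and its derivative along ζ. -/

/-- The trace of `f R(X, Y)`. -/
def ρ (X Y : 𝔛) : A := C.tr fun Z ↦ K.f (C.R X Y Z)

theorem ρ_eq (X Y : 𝔛) : K.ρ X Y = - ∑ i, C.g (C.R X Y (C.e i)) (K.f (C.e i)) := by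
  rw [ρ, tr, ← Finset.sum_neg_distrib]
  refine Finset.sum_congr rfl fun i _ ↦ ?_
  rw [C.g_symm, K.f_skew]

theorem ρ_swap (X Y : 𝔛) : K.ρ X Y = - K.ρ Y X := by
  simp [ρ_eq, C.R_swap X Y]

theorem ρ_add_left (X X' Y : 𝔛) : K.ρ (X + X') Y = K.ρ X Y + K.ρ X' Y := by
  simp [ρ, tr, C.R_add_left, Finset.sum_add_distrib]

theorem ρ_smul_left (a : A) (X Y : 𝔛) : K.ρ (a • X) Y = a * K.ρ X Y := by
  simp [ρ, tr, C.R_smul_left, Finset.mul_sum]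

theorem sum_g_f_mul (X Y : 𝔛) :
    ∑ i, C.g (K.f (C.e i)) X * C.g (C.e i) Y = - C.g (K.f X) Y := by
  rw [← C.sum_g_mul_g, ← Finset.sum_neg_distrib]
  refine Finset.sum_congr rfl fun i _ ↦ ?_
  rw [K.f_skew, C.g_symm (C.e i), C.g_symm (C.e i)]
  ring

/-- Pair symmetry moves ξ_i into the slot covered by `Hor.g_R_ξ`; the two resulting sums over the
frame are equal, whence the factor 2. -/
theorem ρ_ξ_f (i : Fin s) (Y : 𝔛) : K.ρ (K.ξ i) (K.f Y) = - 2 * K.σ i (K.f (K.f Y)) := by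
  have h (Z : 𝔛) : ∑ j, C.g Z (C.e j) * K.σ i (C.e j) = K.σ i Z := by
    conv_rhs => rw [← C.sum_g_smul_e Z]
    simp
  have h' : ∑ j, C.g (K.f Y) (C.e j) * K.σ i (K.f (C.e j)) = K.σ i (K.f (K.f Y)) := by
    conv_rhs => rw [← C.sum_g_smul_e (K.f Y)]
    simp
  have h'' (j) : C.g (C.R (K.ξ i) (K.f Y) (C.e j)) (K.f (C.e j))
      = C.g (K.f Y) (C.e j) * K.σ i (K.f (C.e j)) + C.g (K.f (K.f Y)) (C.e j) * K.σ i (C.e j) := by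
    rw [C.g_R_pair, (K.hor_f Y).g_R_ξ, K.f_skew, C.g_symm (C.e j), C.g_symm (C.e j)]
    ring
  simp only [ρ_eq, h'', Finset.sum_add_distrib, h, h']
  ring

theorem ρ_ζ {Y : 𝔛} (h : K.Hor Y) : K.ρ Y K.ζ = 0 := by
  have h' (i) : C.g (C.R Y K.ζ (C.e i)) (K.f (C.e i))
      = - (s * K.b ^ 2) * (C.g (K.f (C.e i)) Y * C.g (C.e i) K.ζ) := by
    rw [C.g_R_pair, C.g_R_swap, C.g_symm, h.g_R_ζ, (K.hor_f _).g_ζ]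
    ring
  rw [ρ_eq]
  simp only [h', ← Finset.mul_sum, sum_g_f_mul, (K.hor_f _).g_ζ]
  simp

variable {K} in
theorem Hor.nab_ζ {Y : 𝔛} (h : K.Hor Y) : K.Hor (C.nab K.ζ Y) := by
  intro i
  rw [h.g_nab, h.ζ_g]
  simp

variable {K} in
-- The ξ_i-component of ∇_X Y is -b g(X, Y), symmetric in X and Y, so the horizontal distribution is
-- involutive.
theorem Hor.br {X Y : 𝔛} (hX : K.Hor X) (hY : K.Hor Y) : K.Hor (C.br X Y) := by
  intro i
  rw [FramedConnection.br, map_sub, LinearMap.sub_apply, hX.g_nab, hY.g_nab, C.g_symm]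
  ring

theorem _root_.FramedConnection.sum_g_mul_g_map (T : 𝔛 →ₗ[A] 𝔛) (X Y : 𝔛) :
    ∑ i, C.g (C.e i) X * C.g Y (T (C.e i)) = C.g Y (T X) := by
  conv_rhs => rw [← C.sum_g_smul_e X]
  simp only [map_sum, map_smul, smul_eq_mul, C.g_symm X]

variable {K} in
/-- The trace of `f` composed with the covariant derivative of `R(Z, ζ)`. -/
theorem Hor.tr_nab_R {Z : 𝔛} (h : K.Hor Z) (X : 𝔛) :
    C.tr (fun W ↦ K.f (C.nab X (C.R Z K.ζ W) - C.R Z K.ζ (C.nab X W)))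
      = 2 * s ^ 2 * K.b ^ 3 * C.g Z (K.f X) := by
  -- The trace of f R(Z, ζ) vanishes identically, so its derivative does too. Hence the wanted trace
  -- is minus that of (∇_X f) R(Z, ζ), whose two terms `h₃` and `h₄` are opposite before
  -- subtraction; this gives the factor 2.
  have h₁ := C.d_tr X (K.f ∘ₗ C.Rₗ Z K.ζ)
  have h₂ : C.tr (K.f ∘ₗ C.Rₗ Z K.ζ) = 0 := K.ρ_ζ h
  rw [h₂, map_zero] at h₁
  have h₃ : ∑ i, C.g (C.e i) K.ζ * C.g (K.f X) (C.R Z K.ζ (C.e i)) = C.g (K.f X) (C.R Z K.ζ K.ζ) :=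
    C.sum_g_mul_g_map (C.Rₗ Z K.ζ) _ _
  have h₄ : ∑ i, C.g (C.e i) (K.f X) * C.g (C.R Z K.ζ (C.e i)) K.ζ
      = - C.g (K.f X) (C.R Z K.ζ K.ζ) := by
    rw [← C.g_R_swap, C.g_symm]
    simp only [C.g_symm _ K.ζ]
    exact C.sum_g_mul_g_map (C.Rₗ Z K.ζ) _ _
  have h₅ : C.g (K.f X) (C.R Z K.ζ K.ζ) = - (s ^ 2 * K.b ^ 2 * C.g Z (K.f X)) := by
    rw [C.g_symm, (K.hor_f X).g_R_ζ, K.g_ζ_ζ, (K.hor_f X).ζ_g]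
    ring
  have h₆ (W : 𝔛) : C.nab X ((K.f ∘ₗ C.Rₗ Z K.ζ) W) - (K.f ∘ₗ C.Rₗ Z K.ζ) (C.nab X W)
      = K.f (C.nab X (C.R Z K.ζ W) - C.R Z K.ζ (C.nab X W))
        + K.b • (C.g (K.f X) (C.R Z K.ζ W) • K.ζ - C.g (C.R Z K.ζ W) K.ζ • K.f X) := by
    simp only [LinearMap.comp_apply, Rₗ_apply, nab_f_apply, map_sub]
    abel
  simp only [h₆, tr, map_add, map_sub, map_smul, smul_eq_mul, Finset.sum_add_distrib,
    ← Finset.mul_sum, Finset.sum_sub_distrib] at h₁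
  simp only [tr, map_sub, Finset.sum_sub_distrib]
  simp only [mul_comm (C.g (C.e _) _)] at h₃ h₄
  rw [h₃, h₄, h₅] at h₁
  linear_combination -h₁

/-- The condition that `∇_Y ζ` has no component along the characteristic fields. -/
def NabZeta : Prop := ∀ Y, K.Hor Y → C.nab Y K.ζ = (s * K.b) • Y

variable {K}

theorem NabZeta.br_ζ (hζ : K.NabZeta) {X : 𝔛} (hX : K.Hor X) :
    C.br K.ζ X = C.nab K.ζ X - (s * K.b) • X := by
  rw [br, hζ X hX]

/-- The covariant derivative of the trace form along `ζ`. -/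
theorem NabZeta.d_ρ (hζ : K.NabZeta) {X Y : 𝔛} (hX : K.Hor X) (hY : K.Hor Y) :
    C.d K.ζ (K.ρ X Y) = K.ρ (C.nab K.ζ X) Y + K.ρ X (C.nab K.ζ Y) - 2 * (s * K.b) * K.ρ X Y
      + 4 * s ^ 2 * K.b ^ 3 * C.g X (K.f Y) := by
  have h₁ : C.d K.ζ (K.ρ X Y)
      = C.tr (fun W ↦ K.f (C.nab K.ζ (C.R X Y W) - C.R X Y (C.nab K.ζ W))) := by
    have := C.d_tr K.ζ (K.f ∘ₗ C.Rₗ X Y)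
    simp only [LinearMap.comp_apply, Rₗ_apply, nab_ζ_f, ← map_sub] at this
    exact this
  have h₂ := hY.tr_nab_R X
  have h₃ := hX.tr_nab_R Y
  have h₅ : C.br Y K.ζ = (s * K.b) • Y + (-1 : A) • C.nab K.ζ Y := by
    rw [br, hζ Y hY]; module
  have h₆ : C.nab K.ζ X - (s * K.b) • X = C.nab K.ζ X + (- (s * K.b)) • X := by module
  -- Trace of f composed with the second Bianchi identity for ζ, X, Y. The last two commutators are
  -- known from `Hor.tr_nab_R`, which isolates the one with ∇_ζ; the term in [X, Y] drops by
  -- `Hor.br` and `ρ_ζ`.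
  have h₄ : C.tr (fun W ↦ K.f ((C.nab K.ζ (C.R X Y W) - C.R X Y (C.nab K.ζ W))
        + (C.nab X (C.R Y K.ζ W) - C.R Y K.ζ (C.nab X W))
        + (C.nab Y (C.R K.ζ X W) - C.R K.ζ X (C.nab Y W))))
      = K.ρ (C.br K.ζ X) Y + K.ρ (C.br X Y) K.ζ + K.ρ (C.br Y K.ζ) X := by
    have (W : 𝔛) := C.bianchi_second K.ζ X Y W
    have (W : 𝔛) : C.nab K.ζ (C.R X Y W) - C.R X Y (C.nab K.ζ W)
        + (C.nab X (C.R Y K.ζ W) - C.R Y K.ζ (C.nab X W))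
        + (C.nab Y (C.R K.ζ X W) - C.R K.ζ X (C.nab Y W))
        = C.R (C.br K.ζ X) Y W + C.R (C.br X Y) K.ζ W + C.R (C.br Y K.ζ) X W := by
      rw [← C.bianchi_second]
    simp only [this]
    simp [ρ, tr, Finset.sum_add_distrib]
  rw [K.ρ_ζ (hX.br hY), hζ.br_ζ hX, h₅, h₆] at h₄
  simp only [ρ_add_left, ρ_smul_left, C.R_swap K.ζ X] at h₄
  simp only [tr, map_add, map_sub, map_neg, Finset.sum_add_distrib, Finset.sum_sub_distrib,
    Finset.sum_neg_distrib] at h₁ h₂ h₃ h₄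
  have h₇ : C.g Y (K.f X) = - C.g X (K.f Y) := by rw [← K.f_skew, C.g_symm]
  rw [h₇] at h₂
  linear_combination h₁ + h₄ - h₂ + h₃ + (s * K.b) * K.ρ_swap Y X - K.ρ_swap (C.nab K.ζ Y) X

/-- The covariant derivative depends on the horizontal part through the value on `ζ`. -/
theorem g_nab_congr {T N X Y : 𝔛} (h : ∀ Z, K.Hor Z → C.g T Z = C.g N Z) (hY : K.Hor Y) :
    C.g (C.nab X T) Y = C.g (C.nab X N) Y + K.b * C.g X Y * (C.g T K.ζ - C.g N K.ζ) := by
  -- T - N is a combination of the ξ_i, so moving the derivative onto Y leaves only the part -b g(X,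
  -- Y) ζ of ∇_X Y.
  have h₁ := C.d_g X T Y
  have h₂ := C.d_g X N Y
  rw [hY.nab_eq X, map_sub, map_smul, smul_eq_mul] at h₁ h₂
  rw [h Y hY, h _ (K.hor_P _)] at h₁
  linear_combination h₂ - h₁

/-- The second covariant derivative along `ζ`. -/
theorem NabZeta.d_g_nab (hζ : K.NabZeta) (W : 𝔛) {X Y : 𝔛} (hX : K.Hor X) (hY : K.Hor Y) :
    C.d K.ζ (C.g (C.nab X W) Y) = C.g (C.nab (C.nab K.ζ X) W) Y + C.g (C.nab X W) (C.nab K.ζ Y)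
      + s * K.b ^ 2 * C.g W K.ζ * C.g X Y + C.g (C.nab X (C.nab K.ζ W)) Y
      - s * K.b * C.g (C.nab X W) Y := by
  -- Commuting ∇_ζ past ∇_X costs R(ζ, X) and the bracket [ζ, X] = ∇_ζ X - sbX; the latter gives the
  -- final term of the formula.
  have h₁ : C.g (C.R K.ζ X W) Y = s * K.b ^ 2 * C.g W K.ζ * C.g X Y := by
    rw [C.g_R_pair, hX.g_R_ζ, hY.g_ζ, C.g_symm X Y]
    ring
  rw [C.R_apply, hζ.br_ζ hX] at h₁
  simp only [map_sub, LinearMap.sub_apply, AddMonoidHom.sub_apply, map_smul,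
    AddMonoidHom.smul_apply, LinearMap.smul_apply, smul_eq_mul] at h₁
  rw [C.d_g]
  linear_combination h₁

variable (K) in
/-- The `*`-Ricci soliton equation. -/
def Soliton (V : 𝔛) (l : A) : Prop := ∀ X Y,
  C.g (C.nab X V) Y + C.g X (C.nab Y V) + K.ρ X (K.f Y)
    = 2 * l * (C.g X Y - ∑ i, C.g X (K.ξ i) * C.g Y (K.ξ i)) + 2 * l * (C.g X K.ζ * C.g Y K.ζ)

/-! ### Consequences of the soliton equation. -/

namespace Soliton

variable {V : 𝔛} {l : A} (h : K.Soliton V l)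

include h

/-- All other terms of the equation are symmetric, so ρ(X, fY) is symmetric; and f ξ_i = 0. -/
theorem ρ_ξ_f (i : Fin s) {Y : 𝔛} : K.ρ (K.ξ i) (K.f Y) = 0 := by
  have h₁ := h (K.ξ i) Y
  have h₂ := h Y (K.ξ i)
  have h₃ : K.ρ Y (K.f (K.ξ i)) = 0 := by
    rw [K.f_ξ, K.ρ_swap, ← zero_smul A Y, ρ_smul_left]; simp
  rw [h₃, C.g_symm Y (K.ξ i), C.g_symm Y] at h₂
  have h₄ : ∑ j, C.g (K.ξ i) (K.ξ j) * C.g Y (K.ξ j) = ∑ j, C.g Y (K.ξ j) * C.g (K.ξ i) (K.ξ j) :=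
    Finset.sum_congr rfl fun j _ ↦ mul_comm _ _
  rw [C.g_symm (K.ξ i) (C.nab Y V)] at h₁
  rw [h₄] at h₁
  linear_combination h₁ - h₂

theorem nabZeta : K.NabZeta := by
  have hσ (i : Fin s) {Y : 𝔛} (hY : K.Hor Y) : K.σ i Y = 0 := by
    -- N is the field dual to σ_i. As σ_i ∘ f² = 0, also f²N = 0, so N is a combination of the ξ_j
    -- and σ_i vanishes on horizontal fields.
    have hN (X : 𝔛) : K.σ i X = C.g X (∑ j, K.σ i (C.e j) • C.e j) := by
      conv_lhs => rw [← C.sum_g_smul_e X]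
      simp [mul_comm]
    set N := ∑ j, K.σ i (C.e j) • C.e j
    have hf : K.f (K.f N) = 0 := by
      refine C.g_ext fun Z ↦ ?_
      rw [K.f_skew, K.f_skew, neg_neg, C.g_symm, ← hN, map_zero, LinearMap.zero_apply]
      refine C.two_cancel _ ?_
      rw [← neg_inj, ← neg_mul, ← K.ρ_ξ_f, h.ρ_ξ_f, neg_zero]
    rw [hN, K.eq_of_f_f N hf]
    simp [hY _]
  intro Y hY
  refine K.ext_hor (fun Z hZ ↦ ?_) fun i ↦ ?_
  · rw [hZ.g_nab_ζ]; simp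
  · have := hσ i hY
    rw [σ_apply, hY.g_ζ, g_nab_ξ_ζ] at this
    rw [map_smul, LinearMap.smul_apply, hY, smul_zero]
    exact K.b_cancel _ (by linear_combination -this)

theorem g_nab_ζ_ζ : C.g (C.nab K.ζ V) K.ζ = l * s ^ 2 := by
  have h₁ := h K.ζ K.ζ
  have h₃ : K.ρ K.ζ (K.f K.ζ) = 0 := by
    rw [K.f_ζ, K.ρ_swap, ← zero_smul A K.ζ, ρ_smul_left]; simp
  have h₄ : ∑ i, C.g K.ζ (K.ξ i) * C.g K.ζ (K.ξ i) = s := by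
    simp [C.g_symm K.ζ, K.g_ξ_ζ]
  rw [h₃, h₄, C.g_symm K.ζ, K.g_ζ_ζ] at h₁
  rw [← sub_eq_zero]
  exact C.two_cancel _ (by linear_combination h₁)

theorem d_g_ζ : C.d K.ζ (C.g V K.ζ) = l * s ^ 2 := by
  rw [C.d_g, K.nab_ζ_ζ, map_zero, add_zero, h.g_nab_ζ_ζ]

/-- The equation on (ζ, Y) has zero right-hand side and no ρ term; g(∇_Y V, ζ) is rewritten through
the derivative of g(V, ζ), using `nabZeta`. -/
theorem g_nab_ζ {Y : 𝔛} (hY : K.Hor Y) :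
    C.g (C.nab K.ζ V) Y = - C.d Y (C.g V K.ζ) + s * K.b * C.g V Y := by
  have h₁ := h K.ζ Y
  have h₃ : K.ρ K.ζ (K.f Y) = 0 := by
    rw [K.ρ_swap, K.ρ_ζ (K.hor_f Y), neg_zero]
  rw [C.d_g, h.nabZeta Y hY, map_smul, smul_eq_mul]
  simp only [h₃, hY _, hY.ζ_g, hY.g_ζ, mul_zero, Finset.sum_const_zero, C.g_symm K.ζ] at h₁
  linear_combination h₁

theorem hor {X : 𝔛} (hX : K.Hor X) (Y : 𝔛) :
    C.g (C.nab X V) Y + C.g X (C.nab Y V) + K.ρ X (K.f Y) = 2 * l * C.g X Y := by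
  rw [h]
  simp [hX _, hX.g_ζ]

end Soliton

variable (K) in
/-- The gradient of a function. -/
def grad (_ : C.Kenmotsu s) (a : A) : 𝔛 := ∑ i, C.d (C.e i) a • C.e i

theorem g_grad (a : A) (X : 𝔛) : C.g (K.grad a) X = C.d X a := by
  conv_rhs => rw [← C.sum_g_smul_e X]
  simp [grad, LinearMap.sum_apply, AddMonoidHom.finsetSum_apply, C.g_symm X, mul_comm]

/-- Symmetry of the Hessian, equivalent to `d_br` for a torsion-free connection. -/
theorem g_nab_grad_comm (a : A) (X Y : 𝔛) :
    C.g (C.nab X (K.grad a)) Y = C.g (C.nab Y (K.grad a)) X := by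
  have h₁ := C.d_g X (K.grad a) Y
  have h₂ := C.d_g Y (K.grad a) X
  have h₃ := C.d_br X Y a
  rw [← K.g_grad, br, map_sub] at h₃
  simp only [g_grad] at h₁ h₂ h₃
  linear_combination h₂ - h₁ - h₃

namespace Soliton

variable {V : 𝔛} {l : A} (h : K.Soliton V l) (hl : ∀ X, C.d X l = 0)

include h hl

/-- The soliton equation on horizontal fields is differentiated along ζ. The second derivatives of V
become the Hessian of g(V, ζ) through `g_nab_ζ`. -/
theorem hess {X Y : 𝔛} (hX : K.Hor X) (hY : K.Hor Y) :
    C.g (C.nab X (K.grad (C.g V K.ζ))) Y = 2 * K.b * l * s ^ 2 * C.g X Y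
      + 2 * s ^ 2 * K.b ^ 3 * C.g X (K.f (K.f Y)) - s * K.b * K.ρ X (K.f Y) := by
  have hζ := h.nabZeta
  have hs (X : 𝔛) : C.d X (s * K.b) = 0 := by rw [← nsmul_eq_mul, map_nsmul, K.d_b, smul_zero]
  have hl₂ : C.d K.ζ (2 * l) = 0 := by rw [two_mul, map_add, hl, add_zero]
  -- ∇_ζ V and sbV - grad φ have the same horizontal part. Their products with ζ are ls² and sbφ -
  -- ls², and the last factor is the difference.
  have key {X Y : 𝔛} (hY : K.Hor Y) : C.g (C.nab X (C.nab K.ζ V)) Y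
      = s * K.b * C.g (C.nab X V) Y - C.g (C.nab X (K.grad (C.g V K.ζ))) Y
        + K.b * C.g X Y * (2 * (l * s ^ 2) - s * K.b * C.g V K.ζ) := by
    rw [g_nab_congr (K := K) (N := (s * K.b) • V - K.grad (C.g V K.ζ)) _ hY]
    · simp only [map_sub, C.nab_smul, hs, map_smul, zero_smul, add_zero,
        LinearMap.sub_apply, LinearMap.smul_apply, smul_eq_mul, g_grad, h.d_g_ζ, h.g_nab_ζ_ζ]
      ring
    · intro Z hZ
      rw [h.g_nab_ζ hZ]
      simp [g_grad]
      ring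
  have h₀ := congr(C.d K.ζ $(h.hor hX Y))
  rw [map_add, map_add, C.g_symm X, hζ.d_g_nab V hX hY, hζ.d_g_nab V hY hX,
    hζ.d_ρ hX (K.hor_f Y), nab_ζ_f, C.d_mul, hl₂, C.d_g, key hY, key hX] at h₀
  have h₁ := h.hor hX.nab_ζ Y
  have h₂ := h.hor hX (C.nab K.ζ Y)
  rw [C.g_symm _ (C.nab Y V)] at h₁
  rw [C.g_symm X (C.nab (C.nab K.ζ Y) V)] at h₂
  rw [g_nab_grad_comm _ Y X, C.g_symm Y X] at h₀
  rw [← sub_eq_zero]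
  refine C.two_cancel _ ?_
  linear_combination h₁ + h₂ - h₀

/-- Differentiate `hess` once more along ζ. The Hessian and ρ(·, f·) satisfy linear equations with
the same rate -2sb, so both can be eliminated. -/
theorem eq_zero : (s : A) ^ 3 * l = 0 := by
  have hζ := h.nabZeta
  have hφ : ∀ X, C.d X (l * s ^ 2) = 0 := by
    intro X
    rw [mul_comm, ← Nat.cast_pow, ← nsmul_eq_mul, map_nsmul, hl, smul_zero]
  have hc₁ : C.d K.ζ (2 * K.b * l * s ^ 2) = 0 := by
    rw [mul_assoc, C.d_mul, hφ, two_mul, map_add, K.d_b]; ring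
  have hc₂ : C.d K.ζ (2 * s ^ 2 * K.b ^ 3) = 0 := by
    have hb : C.d K.ζ (K.b ^ 3) = 0 := by simp [pow_succ, C.d_mul, K.d_b]
    have : (2 * s ^ 2 * K.b ^ 3 : A) = (2 * s ^ 2 : ℕ) • K.b ^ 3 := by simp
    rw [this, map_nsmul, hb, smul_zero]
  have hs (X : 𝔛) : C.d X (s * K.b) = 0 := by rw [← nsmul_eq_mul, map_nsmul, K.d_b, smul_zero]
  have hmul {c : A} (hc : C.d K.ζ c = 0) (a : A) : C.d K.ζ (c * a) = c * C.d K.ζ a := by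
    rw [C.d_mul, hc, mul_zero, add_zero]
  set G := K.grad (C.g V K.ζ) with hG
  have hGζ : C.g G K.ζ = l * s ^ 2 := by rw [g_grad, h.d_g_ζ]
  have hGζζ : C.g (C.nab K.ζ G) K.ζ = 0 := by
    have := C.d_g K.ζ G K.ζ
    rw [hGζ, hφ, K.nab_ζ_ζ, map_zero, add_zero] at this
    exact this.symm
  have hX : K.Hor K.X₀ := K.g_X₀_ξ
  -- As g(G, ζ) is constant, differentiating it along horizontal Z and using the symmetry of the
  -- Hessian shows that ∇_ζ G and -sbG have the same horizontal part.
  have key : C.g (C.nab K.X₀ (C.nab K.ζ G)) K.X₀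
      = - (s * K.b) * C.g (C.nab K.X₀ G) K.X₀
        + K.b * C.g K.X₀ K.X₀ * (s * K.b * (l * s ^ 2)) := by
    rw [g_nab_congr (K := K) (N := - ((s * K.b) • G)) _ hX]
    · simp only [map_neg, C.nab_smul, hs, map_smul, zero_smul, add_zero,
        LinearMap.neg_apply, LinearMap.smul_apply, smul_eq_mul, hGζ, hGζζ]
      ring
    · intro Z hZ
      have := C.d_g Z G K.ζ
      rw [hGζ, hφ, hζ Z hZ, ← g_nab_grad_comm, ← hG] at this
      simp only [map_neg, map_smul, LinearMap.neg_apply, LinearMap.smul_apply, smul_eq_mul]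
        at this ⊢
      linear_combination -this
  have h₀ := congr(C.d K.ζ $(h.hess hl hX hX))
  rw [← hG, hζ.d_g_nab G hX hX, map_sub, map_add, hmul hc₁, hmul hc₂, hmul (hs _),
    hζ.d_ρ hX (K.hor_f _), C.d_g, C.d_g, nab_ζ_f, nab_ζ_f, key, hGζ] at h₀
  have h₁ := h.hess hl hX hX
  have h₂ := h.hess hl hX.nab_ζ hX
  have h₃ := h.hess hl hX hX.nab_ζ
  rw [← hG] at h₁ h₂ h₃
  refine K.b_cancel _ (K.b_cancel _ (K.X₀_cancel _ (C.two_cancel _ ?_)))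
  -- `h₂` and `h₃` remove the terms in ∇_ζ X₀, and 2sb times `h₁` removes the Hessian and ρ. What
  -- survives is 2b²s³l g(X₀, X₀).
  linear_combination h₂ + h₃ - h₀ - 2 * s * K.b * h₁

end Soliton

end Kenmotsu

end FramedConnection

noncomputable section

namespace WeakKenmotsu

open Topology

/-! ### Smooth functions and vector fields on an open set. -/

section Manifold

variable {E : Type*} [NormedAddCommGroup E] [NormedSpace ℝ E]
  {M : Type*} [TopologicalSpace M] [ChartedSpace E M] {U : Set M}

variable (E U) in
/-- The algebra of smooth functions on `U`. -/
def SmoothFunctions : Subalgebra ℝ (U → ℝ) where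
  carrier := {a | ∃ h : M → ℝ, CMDiff[U] ∞ h ∧ ∀ x : U, a x = h x}
  mul_mem' := by
    rintro a b ⟨h, hh, ha⟩ ⟨k, hk, hb⟩
    exact ⟨h * k, hh.mul hk, fun x ↦ by simp [ha, hb]⟩
  add_mem' := by
    rintro a b ⟨h, hh, ha⟩ ⟨k, hk, hb⟩
    exact ⟨h + k, hh.add hk, fun x ↦ by simp [ha, hb]⟩
  algebraMap_mem' c := ⟨fun _ ↦ c, contMDiffOn_const, fun x ↦ rfl⟩

namespace SmoothFunctions

/-- The extension by zero. -/
def ext (a : SmoothFunctions E U) : M → ℝ := Function.extend Subtype.val a.1 0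

theorem ext_apply (a : SmoothFunctions E U) {x : M} (hx : x ∈ U) : ext a x = a.1 ⟨x, hx⟩ :=
  Subtype.val_injective.extend_apply a.1 0 ⟨x, hx⟩

theorem contMDiffOn_ext (a : SmoothFunctions E U) : CMDiff[U] ∞ (ext a) := by
  obtain ⟨h, hh, ha⟩ := a.2
  exact hh.congr fun x hx ↦ by rw [ext_apply a hx, ha]

/-- The restriction to `U` of a function that is smooth on `U`. -/
def restrict (h : M → ℝ) (hh : CMDiff[U] ∞ h) : SmoothFunctions E U :=
  ⟨fun x ↦ h x, h, hh, fun _ ↦ rfl⟩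

theorem ext_restrict (h : M → ℝ) (hh : CMDiff[U] ∞ h) {x : M} (hx : x ∈ U) :
    ext (restrict h hh) x = h x := ext_apply _ hx

@[ext]
theorem ext_eq {a b : SmoothFunctions E U} (h : ∀ x : U, a.1 x = b.1 x) : a = b :=
  Subtype.ext (funext h)

theorem mdifferentiableAt_ext (hU : IsOpen U) (a : SmoothFunctions E U) {x : M} (hx : x ∈ U) :
    MDiffAt (ext a) x :=
  ((contMDiffOn_ext a).contMDiffAt (hU.mem_nhds hx)).mdifferentiableAt (by simp)

theorem ext_add (a b : SmoothFunctions E U) : ext (a + b) = ext a + ext b := by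
  ext x
  by_cases hx : x ∈ U
  · simp [ext_apply _ hx]
  · have (a : SmoothFunctions E U) : ext a x = 0 := Function.extend_apply' _ _ _ (by simpa)
    simp [this]

theorem ext_mul (a b : SmoothFunctions E U) : ext (a * b) = ext a * ext b := by
  ext x
  by_cases hx : x ∈ U
  · simp [ext_apply _ hx]
  · have (a : SmoothFunctions E U) : ext a x = 0 := Function.extend_apply' _ _ _ (by simpa)
    simp [this]

end SmoothFunctions

variable [IsManifold 𝓘(ℝ, E) ∞ M]

variable (E U) in
/-- The vector fields that are smooth on `U` and vanish outside `U`. -/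
def SmoothFields : AddSubgroup (Π x : M, TangentSpace 𝓘(ℝ, E) x) where
  carrier := {X | CMDiff[U] ∞ (T% X) ∧ ∀ x ∉ U, X x = 0}
  add_mem' := by
    rintro X Y ⟨hX, hX'⟩ ⟨hY, hY'⟩
    exact ⟨hX.add_section hY, fun x hx ↦ by simp [hX' x hx, hY' x hx]⟩
  zero_mem' := ⟨(contMDiff_zeroSection ℝ _).contMDiffOn, fun _ _ ↦ rfl⟩
  neg_mem' := by
    rintro X ⟨hX, hX'⟩
    exact ⟨hX.neg_section, fun x hx ↦ by simp [hX' x hx]⟩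

namespace SmoothFields

theorem contMDiffOn (X : SmoothFields E U) : CMDiff[U] ∞ (T% X.1) := X.2.1

theorem apply_of_notMem (X : SmoothFields E U) {x : M} (hx : x ∉ U) : X.1 x = 0 := X.2.2 x hx

theorem contMDiffAt (hU : IsOpen U) (X : SmoothFields E U) {x : M} (hx : x ∈ U) :
    CMDiffAt ∞ (T% X.1) x :=
  (contMDiffOn X).contMDiffAt (hU.mem_nhds hx)

theorem mdifferentiableAt (hU : IsOpen U) (X : SmoothFields E U) {x : M} (hx : x ∈ U) :
    MDiffAt (T% X.1) x :=
  (contMDiffAt hU X hx).mdifferentiableAt (by simp)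

theorem ext_eq {X Y : SmoothFields E U} (h : ∀ x ∈ U, X.1 x = Y.1 x) : X = Y := by
  refine Subtype.ext (funext fun x ↦ ?_)
  by_cases hx : x ∈ U
  · exact h x hx
  · rw [apply_of_notMem X hx, apply_of_notMem Y hx]

open Classical in
/-- The restriction to `U` of a vector field that is smooth on `U`. -/
def restrict (X : Π x : M, TangentSpace 𝓘(ℝ, E) x) (hX : CMDiff[U] ∞ (T% X)) :
    SmoothFields E U :=
  ⟨fun x ↦ if x ∈ U then X x else 0, hX.congr fun x hx ↦ by simp [hx], fun x hx ↦ by simp [hx]⟩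

theorem restrict_apply {X : Π x : M, TangentSpace 𝓘(ℝ, E) x} {hX : CMDiff[U] ∞ (T% X)} {x : M}
    (hx : x ∈ U) : (restrict X hX).1 x = X x := if_pos hx

theorem restrict_eventuallyEq (hU : IsOpen U) {X : Π x : M, TangentSpace 𝓘(ℝ, E) x}
    {hX : CMDiff[U] ∞ (T% X)} {x : M} (hx : x ∈ U) : (restrict X hX).1 =ᶠ[𝓝 x] X :=
  Filter.eventually_of_mem (hU.mem_nhds hx) fun _ hy ↦ restrict_apply hy

/-- Functions act through their extension by zero; the unit law holds because the fields vanish off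
U. -/
instance : Module (SmoothFunctions E U) (SmoothFields E U) where
  smul a X := ⟨SmoothFunctions.ext a • X.1, (SmoothFunctions.contMDiffOn_ext a).smul_section X.2.1,
    fun x hx ↦ by simp [X.2.2 x hx]⟩
  one_smul X := ext_eq fun x hx ↦ by
    change SmoothFunctions.ext 1 x • X.1 x = X.1 x
    simp [SmoothFunctions.ext_apply _ hx]
  mul_smul a b X := ext_eq fun x hx ↦ by
    change SmoothFunctions.ext (a * b) x • X.1 x
      = SmoothFunctions.ext a x • SmoothFunctions.ext b x • X.1 x
    simp [SmoothFunctions.ext_mul, mul_smul]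
  smul_zero a := ext_eq fun x hx ↦ smul_zero _
  smul_add a X Y := ext_eq fun x hx ↦ smul_add _ _ _
  add_smul a b X := ext_eq fun x hx ↦ by
    change SmoothFunctions.ext (a + b) x • X.1 x
      = SmoothFunctions.ext a x • X.1 x + SmoothFunctions.ext b x • X.1 x
    simp [SmoothFunctions.ext_add, add_smul]
  zero_smul X := ext_eq fun x hx ↦ by
    change SmoothFunctions.ext 0 x • X.1 x = 0
    simp [SmoothFunctions.ext_apply _ hx]

theorem coe_smul (a : SmoothFunctions E U) (X : SmoothFields E U) :
    (a • X).1 = SmoothFunctions.ext a • X.1 := rfl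

theorem smul_apply (a : SmoothFunctions E U) (X : SmoothFields E U) (x : U) :
    (a • X).1 x = a.1 x • X.1 x := by
  rw [coe_smul, Pi.smul_apply', SmoothFunctions.ext_apply a x.2]

theorem sum_apply {ι : Type*} (t : Finset ι) (X : ι → SmoothFields E U) (x : M) :
    (∑ i ∈ t, X i).1 x = ∑ i ∈ t, (X i).1 x := by
  rw [AddSubgroup.val_finsetSum, Finset.sum_apply]

theorem _root_.WeakKenmotsu.contMDiffOn_mvfderiv_apply (hU : IsOpen U) {h : M → ℝ}
    (hh : CMDiff[U] ∞ h) {X : Π x : M, TangentSpace 𝓘(ℝ, E) x} (hX : CMDiff[U] ∞ (T% X)) :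
    CMDiff[U] ∞ (fun x ↦ mvfderiv 𝓘(ℝ, E) h x (X x)) := by
  have : IsManifold 𝓘(ℝ, E) 1 M := .of_le (n := ∞) (by simp)
  have h₁ := hh.contMDiffOn_tangentMapWithin (m := ∞) (by simp) hU.uniqueMDiffOn
  have h₂ := (contMDiff_snd_tangentBundle_modelSpace ℝ 𝓘(ℝ, ℝ) (n := ∞)).comp_contMDiffOn
    (h₁.comp hX fun x hx ↦ hx)
  refine h₂.congr fun x hx ↦ ?_
  exact congr($((mfderivWithin_of_isOpen hU hx).symm) (X x))

/-- The derivative of a function along a vector field. -/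
def deriv (hU : IsOpen U) (X : SmoothFields E U) (a : SmoothFunctions E U) :
    SmoothFunctions E U :=
  SmoothFunctions.restrict (fun x ↦ mvfderiv 𝓘(ℝ, E) (SmoothFunctions.ext a) x (X.1 x)) <|
    contMDiffOn_mvfderiv_apply hU (SmoothFunctions.contMDiffOn_ext a) (contMDiffOn X)

theorem deriv_apply (hU : IsOpen U) (X : SmoothFields E U) (a : SmoothFunctions E U) (x : U) :
    (deriv hU X a).1 x = mvfderiv 𝓘(ℝ, E) (SmoothFunctions.ext a) x (X.1 x) := rfl

theorem deriv_restrict (hU : IsOpen U) (X : SmoothFields E U) {h : M → ℝ} (hh : CMDiff[U] ∞ h)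
    (x : U) :
    (deriv hU X (SmoothFunctions.restrict h hh)).1 x = mvfderiv 𝓘(ℝ, E) h x (X.1 x) := by
  have : SmoothFunctions.ext (SmoothFunctions.restrict h hh) =ᶠ[𝓝 x.1] h :=
    Filter.eventually_of_mem (hU.mem_nhds x.2) fun y hy ↦ SmoothFunctions.ext_restrict h hh hy
  exact congr($(this.mfderiv_eq) (X.1 x))

end SmoothFields

end Manifold

/-! ### Orthonormal frames and the Levi-Civita connection as a `FramedConnection`. -/

section Riemannian

variable {E : Type*} [NormedAddCommGroup E] [NormedSpace ℝ E] [FiniteDimensional ℝ E]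
  {M : Type*} [TopologicalSpace M] [ChartedSpace E M] [IsManifold 𝓘(ℝ, E) ∞ M]
  [RiemannianBundle (fun x : M ↦ TangentSpace 𝓘(ℝ, E) x)]
  [IsContMDiffRiemannianBundle 𝓘(ℝ, E) ∞ E (fun x : M ↦ TangentSpace 𝓘(ℝ, E) x)] {U : Set M}

theorem contMDiffOn_inner {X Y : Π x : M, TangentSpace 𝓘(ℝ, E) x}
    (hX : CMDiff[U] ∞ (T% X)) (hY : CMDiff[U] ∞ (T% Y)) :
    CMDiff[U] ∞ (fun x ↦ (inner ℝ (X x) (Y x) : ℝ)) :=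
  ContMDiffOn.inner_bundle (E := fun x : M ↦ TangentSpace 𝓘(ℝ, E) x) hX hY

theorem contMDiffOn_sum_section {ι : Type*} {t : Finset ι}
    {X : ι → Π x : M, TangentSpace 𝓘(ℝ, E) x} (hX : ∀ i ∈ t, CMDiff[U] ∞ (T% (X i))) :
    CMDiff[U] ∞ (T% (fun x ↦ ∑ i ∈ t, X i x)) :=
  ContMDiffOn.sum_section hX

theorem contMDiffOn_gramSchmidt {m : ℕ} {b : Fin m → Π x : M, TangentSpace 𝓘(ℝ, E) x}
    (hb : ∀ i, CMDiff[U] ∞ (T% (b i))) (hl : ∀ x ∈ U, LinearIndependent ℝ (fun i ↦ b i x))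
    (i : Fin m) :
    CMDiff[U] ∞ (T% (fun x ↦ InnerProductSpace.gramSchmidt ℝ (fun i ↦ b i x) i)) := by
  induction i using WellFoundedLT.induction with
  | ind i ih =>
    simp only [InnerProductSpace.gramSchmidt_def ℝ _ i]
    refine ContMDiffOn.sub_section (hb i) (contMDiffOn_sum_section fun j hj ↦ ?_)
    have hj' := ih j (Finset.mem_Iio.mp hj)
    simp only [Submodule.starProjection_singleton]
    refine ContMDiffOn.smul_section (ContMDiffOn.div₀ (contMDiffOn_inner hj' (hb i)) ?_ ?_) hj'
    · refine (contMDiffOn_inner hj' hj').congr fun x _ ↦ ?_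
      rw [real_inner_self_eq_norm_sq, RCLike.ofReal_real_eq_id, id_def]
    · intro x hx
      have := InnerProductSpace.gramSchmidt_ne_zero j (hl x hx)
      rw [RCLike.ofReal_real_eq_id, id_def]
      exact pow_ne_zero 2 (norm_ne_zero_iff.mpr this)

theorem exists_orthonormalFrame (x₀ : M) :
    ∃ W : Set M, IsOpen W ∧ x₀ ∈ W ∧
      ∃ e : Fin (Module.finrank ℝ E) → Π x : M, TangentSpace 𝓘(ℝ, E) x,
        (∀ i, CMDiff[W] ∞ (T% (e i))) ∧ ∀ x ∈ W, Orthonormal ℝ (fun i ↦ e i x) := by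
  let t := trivializationAt E (TangentSpace 𝓘(ℝ, E)) x₀
  have hf := t.isLocalFrameOn_localFrame_baseSet 𝓘(ℝ, E) ∞ (Module.finBasis ℝ E)
  refine ⟨t.baseSet, t.open_baseSet, FiberBundle.mem_baseSet_trivializationAt' x₀,
    fun i x ↦ InnerProductSpace.gramSchmidtNormed ℝ
      (fun i ↦ t.localFrame (Module.finBasis ℝ E) i x) i, fun i ↦ ?_, fun x hx ↦ ?_⟩
  · have hg := contMDiffOn_gramSchmidt (U := t.baseSet) hf.contMDiffOn
      (fun x hx ↦ hf.linearIndependent hx) i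
    refine ContMDiffOn.smul_section (ContMDiffOn.inv₀ (fun x hx ↦ ?_) fun x hx ↦ ?_) hg
    · have hx' := InnerProductSpace.gramSchmidt_ne_zero i (hf.linearIndependent hx)
      have h₁ := (Real.contDiffAt_sqrt (n := ∞)
        (inner_self_ne_zero (𝕜 := ℝ).mpr hx')).contMDiffAt.comp_contMDiffWithinAt x
        (contMDiffOn_inner hg hg x hx)
      refine h₁.congr (fun y _ ↦ ?_) ?_ <;>
      simp
    · have := InnerProductSpace.gramSchmidt_ne_zero i (hf.linearIndependent hx)
      simpa using this
  · exact InnerProductSpace.gramSchmidtNormed_orthonormal (hf.linearIndependent hx)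

theorem sum_inner_smul {ι : Type*} [Fintype ι] {x : M} {e : ι → TangentSpace 𝓘(ℝ, E) x}
    (he : Orthonormal ℝ e)
    (hι : Fintype.card ι = Module.finrank ℝ E) (u : TangentSpace 𝓘(ℝ, E) x) :
    ∑ i, (inner ℝ u (e i) : ℝ) • e i = u := by
  have hs : ⊤ ≤ Submodule.span ℝ (Set.range e) :=
    (he.linearIndependent.span_eq_top_of_card_eq_finrank' hι).ge
  simpa [real_inner_comm] using (OrthonormalBasis.mk he hs).sum_repr' u

theorem contMDiffOn_mlieBracket (hU : IsOpen U) {X Y : Π x : M, TangentSpace 𝓘(ℝ, E) x}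
    (hX : CMDiff[U] ∞ (T% X)) (hY : CMDiff[U] ∞ (T% Y)) :
    CMDiff[U] ∞ (T% (mlieBracket 𝓘(ℝ, E) X Y)) := fun x hx ↦ by
  have : IsManifold 𝓘(ℝ, E) ((⊤ : ℕ∞) + 1) M := .of_le (n := ∞) (by simp)
  have : IsManifold 𝓘(ℝ, E) (minSmoothness ℝ 2) M := by
    rw [minSmoothness_of_isRCLikeNormedField]
    exact .of_le (n := ∞) (WithTop.coe_le_coe.mpr le_top)
  exact (ContMDiffAt.mlieBracket_vectorField (m := ⊤) (n := ⊤) (hX.contMDiffAt (hU.mem_nhds hx))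
    (hY.contMDiffAt (hU.mem_nhds hx)) (by simp)).contMDiffWithinAt

theorem contMDiffOn_koszul (hU : IsOpen U) {X Y Z : Π x : M, TangentSpace 𝓘(ℝ, E) x}
    (hX : CMDiff[U] ∞ (T% X)) (hY : CMDiff[U] ∞ (T% Y)) (hZ : CMDiff[U] ∞ (T% Z)) :
    CMDiff[U] ∞ (koszul X Y Z) := by
  have d {X Y Z : Π x : M, TangentSpace 𝓘(ℝ, E) x}
      (hX : CMDiff[U] ∞ (T% X)) (hY : CMDiff[U] ∞ (T% Y)) (hZ : CMDiff[U] ∞ (T% Z)) :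
      CMDiff[U] ∞ (dirDerivInner X Y Z) :=
    contMDiffOn_mvfderiv_apply hU (contMDiffOn_inner hY hZ) hX
  have l {X Y Z : Π x : M, TangentSpace 𝓘(ℝ, E) x}
      (hX : CMDiff[U] ∞ (T% X)) (hY : CMDiff[U] ∞ (T% Y)) (hZ : CMDiff[U] ∞ (T% Z)) :=
    contMDiffOn_inner (contMDiffOn_mlieBracket hU hX hY) hZ
  exact contMDiffOn_const.mul ((((((d hX hY hZ).add (d hY hZ hX)).sub (d hZ hX hY)).add
    (l hX hY hZ)).sub (l hY hZ hX)).add (l hZ hX hY))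

/-- In a local orthonormal frame the coefficients of ∇_X Y are Koszul expressions, which are smooth.
-/
theorem contMDiffOn_leviCivita (hU : IsOpen U) {X Y : Π x : M, TangentSpace 𝓘(ℝ, E) x}
    (hX : CMDiff[U] ∞ (T% X)) (hY : CMDiff[U] ∞ (T% Y)) :
    CMDiff[U] ∞ (T% (fun x ↦ leviCivita Y x (X x))) := fun x₀ hx₀ ↦ by
  obtain ⟨W, hW, hx₀W, e, he, he'⟩ := exists_orthonormalFrame (E := E) x₀
  have hUW := hU.inter hW
  have h : CMDiff[U ∩ W] ∞ (T% (fun x ↦ leviCivita Y x (X x))) := by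
    have h₁ : CMDiff[U ∩ W] ∞ (T% (fun x ↦ ∑ i, koszul X Y (e i) x • e i x)) := by
      refine contMDiffOn_sum_section fun i _ ↦ ?_
      have hei : CMDiff[U ∩ W] ∞ (T% (e i)) := (he i).mono Set.inter_subset_right
      exact (contMDiffOn_koszul hUW (hX.mono Set.inter_subset_left)
        (hY.mono Set.inter_subset_left) hei).smul_section hei
    refine h₁.congr fun x hx ↦ ?_
    have hd {Z : Π x : M, TangentSpace 𝓘(ℝ, E) x} {W : Set M} (hW : IsOpen W) (hx : x ∈ W)
        (hZ : CMDiff[W] ∞ (T% Z)) : MDiffAt (T% Z) x :=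
      (hZ.contMDiffAt (hW.mem_nhds hx)).mdifferentiableAt (by simp)
    congr 1
    rw [← sum_inner_smul (he' x hx.2) (by simp) (leviCivita Y x (X x))]
    simp only [inner_leviCivita (hd hU hx.1 hX) (hd hU hx.1 hY) (hd hW hx.2 (he _))]
  exact (h.contMDiffAt (hUW.mem_nhds ⟨hx₀, hx₀W⟩)).contMDiffWithinAt

theorem leviCivita_congr {Y Y' : Π x : M, TangentSpace 𝓘(ℝ, E) x} {x : M}
    (hY : MDiffAt (T% Y) x) (h : Y =ᶠ[𝓝 x] Y') : leviCivita Y x = leviCivita Y' x := by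
  refine leviCivita.isCovariantDerivativeOnUniv.congr_of_eventuallyEq hY ?_ Filter.univ_mem h
  refine hY.congr_of_eventuallyEq ?_
  filter_upwards [h] with y hy
  rw [hy]

namespace SmoothFields

/-- The Riemannian metric. -/
def metric : SmoothFields E U →ₗ[SmoothFunctions E U] SmoothFields E U →ₗ[SmoothFunctions E U]
    SmoothFunctions E U :=
  LinearMap.mk₂ _ (fun X Y ↦ SmoothFunctions.restrict (fun x ↦ inner ℝ (X.1 x) (Y.1 x))
      (contMDiffOn_inner (contMDiffOn X) (contMDiffOn Y)))
    (fun X X' Y ↦ SmoothFunctions.ext_eq fun x ↦ inner_add_left _ _ _)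
    (fun a X Y ↦ SmoothFunctions.ext_eq fun x ↦ by
      change inner ℝ ((a • X).1 x) (Y.1 x) = a.1 x * inner ℝ (X.1 x) (Y.1 x)
      rw [smul_apply, real_inner_smul_left])
    (fun X Y Y' ↦ SmoothFunctions.ext_eq fun x ↦ inner_add_right _ _ _)
    (fun a X Y ↦ SmoothFunctions.ext_eq fun x ↦ by
      change inner ℝ (X.1 x) ((a • Y).1 x) = a.1 x * inner ℝ (X.1 x) (Y.1 x)
      rw [smul_apply, real_inner_smul_right])

theorem metric_apply (X Y : SmoothFields E U) (x : U) :
    (metric X Y).1 x = inner ℝ (X.1 x) (Y.1 x) := rfl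

/-- The derivative of functions along vector fields. -/
def derivₗ (hU : IsOpen U) : SmoothFields E U →ₗ[SmoothFunctions E U]
    SmoothFunctions E U →+ SmoothFunctions E U where
  toFun X := AddMonoidHom.mk' (deriv hU X) fun a b ↦ SmoothFunctions.ext_eq fun x ↦ by
    have ha := SmoothFunctions.mdifferentiableAt_ext hU a x.2
    have hb := SmoothFunctions.mdifferentiableAt_ext hU b x.2
    rw [deriv_apply, SmoothFunctions.ext_add, mvfderiv_add ha hb]
    rfl
  map_add' X Y := AddMonoidHom.ext fun a ↦ SmoothFunctions.ext_eq fun x ↦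
    map_add (mvfderiv 𝓘(ℝ, E) (SmoothFunctions.ext a) x) (X.1 x) (Y.1 x)
  map_smul' c X := AddMonoidHom.ext fun a ↦ SmoothFunctions.ext_eq fun x ↦ by
    change mvfderiv 𝓘(ℝ, E) (SmoothFunctions.ext a) x ((c • X).1 x)
      = c.1 x * mvfderiv 𝓘(ℝ, E) (SmoothFunctions.ext a) x (X.1 x)
    rw [smul_apply, map_smul, smul_eq_mul]

/-- The Levi-Civita connection. -/
def nabla (hU : IsOpen U) : SmoothFields E U →ₗ[SmoothFunctions E U]
    SmoothFields E U →+ SmoothFields E U where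
  toFun X := AddMonoidHom.mk' (fun Y ↦ ⟨fun x ↦ leviCivita Y.1 x (X.1 x),
      contMDiffOn_leviCivita hU (contMDiffOn X) (contMDiffOn Y),
      fun x hx ↦ by beta_reduce; rw [apply_of_notMem X hx, map_zero]⟩)
    fun Y Z ↦ ext_eq fun x hx ↦
      congr($((leviCivita (E := E) (M := M)).isCovariantDerivativeOnUniv.add
        (mdifferentiableAt hU Y hx) (mdifferentiableAt hU Z hx)) (X.1 x))
  map_add' X Y := AddMonoidHom.ext fun Z ↦ ext_eq fun x hx ↦
    map_add (leviCivita Z.1 x) (X.1 x) (Y.1 x)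
  map_smul' c X := AddMonoidHom.ext fun Z ↦ ext_eq fun x hx ↦
    map_smul (leviCivita Z.1 x) (SmoothFunctions.ext c x) (X.1 x)

theorem nabla_sub_nabla_eq_mlieBracket (hU : IsOpen U) (X Y : SmoothFields E U) {x : M}
    (hx : x ∈ U) :
    (nabla hU X Y - nabla hU Y X).1 x = mlieBracket 𝓘(ℝ, E) X.1 Y.1 x :=
  ((CovariantDerivative.torsion_eq_zero_iff _).mp leviCivita_torsion)
    (mdifferentiableAt hU X hx) (mdifferentiableAt hU Y hx)

/-- The algebra of smooth functions and fields on an open set with an orthonormal frame. -/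
def framedConnection (hU : IsOpen U) (e : Fin (Module.finrank ℝ E) → SmoothFields E U)
    (he : ∀ x ∈ U, Orthonormal ℝ (fun i ↦ (e i).1 x)) (hE : 0 < Module.finrank ℝ E) :
    FramedConnection (SmoothFunctions E U) (SmoothFields E U) (Fin (Module.finrank ℝ E)) where
  d := derivₗ hU
  d_mul X a b := SmoothFunctions.ext_eq fun x ↦ by
    change (deriv hU X (a * b)).1 x = a.1 x * (deriv hU X b).1 x + b.1 x * (deriv hU X a).1 x
    simp only [deriv_apply, SmoothFunctions.ext_mul]
    rw [mvfderiv_mul (SmoothFunctions.mdifferentiableAt_ext hU a x.2)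
      (SmoothFunctions.mdifferentiableAt_ext hU b x.2), SmoothFunctions.ext_apply a x.2,
      SmoothFunctions.ext_apply b x.2]
    rfl
  g := metric
  g_symm X Y := SmoothFunctions.ext_eq fun x ↦ real_inner_comm _ _
  nab := nabla hU
  nab_smul X a Y := ext_eq fun x hx ↦ by
    have := congr($((leviCivita (E := E) (M := M)).isCovariantDerivativeOnUniv.leibniz
      (mdifferentiableAt hU Y hx) (SmoothFunctions.mdifferentiableAt_ext hU a hx)) (X.1 x))
    refine this.trans ?_
    have h : (deriv hU X a • Y).1 x
      = mvfderiv 𝓘(ℝ, E) (SmoothFunctions.ext a) x (X.1 x) • Y.1 x :=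
        smul_apply (deriv hU X a) Y ⟨x, hx⟩
    have h' : (a • nabla hU X Y).1 x = SmoothFunctions.ext a x • leviCivita Y.1 x (X.1 x) := rfl
    change _ = (a • nabla hU X Y).1 x + (deriv hU X a • Y).1 x
    rw [h, h']
    rfl
  d_g X Y Z := SmoothFunctions.ext_eq fun x ↦ by
    refine (deriv_restrict hU X _ x).trans ?_
    exact leviCivita_metric (mdifferentiableAt hU X x.2) (mdifferentiableAt hU Y x.2)
      (mdifferentiableAt hU Z x.2)
  jacobi X Y Z := ext_eq fun x hx ↦ by
    have hb (X Y Z : SmoothFields E U) :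
        mlieBracket 𝓘(ℝ, E) X.1 (nabla hU Y Z - nabla hU Z Y).1 x
          = mlieBracket 𝓘(ℝ, E) X.1 (mlieBracket 𝓘(ℝ, E) Y.1 Z.1) x := by
      refine Filter.EventuallyEq.mlieBracket_vectorField_eq .rfl ?_
      exact Filter.eventually_of_mem (hU.mem_nhds hx) fun y hy ↦
        nabla_sub_nabla_eq_mlieBracket hU Y Z hy
    have hs (X : SmoothFields E U) : CMDiffAt (minSmoothness ℝ 2) (T% X.1) x := by
      rw [minSmoothness_of_isRCLikeNormedField]
      exact (contMDiffAt hU X hx).of_le (WithTop.coe_le_coe.mpr le_top)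
    have hM : IsManifold 𝓘(ℝ, E) (minSmoothness ℝ 3) M := by
      rw [minSmoothness_of_isRCLikeNormedField]
      exact .of_le (n := ∞) (WithTop.coe_le_coe.mpr le_top)
    change _ = (nabla hU (nabla hU X Y - nabla hU Y X) Z
      - nabla hU Z (nabla hU X Y - nabla hU Y X)).1 x + (nabla hU Y (nabla hU X Z - nabla hU Z X)
      - nabla hU (nabla hU X Z - nabla hU Z X) Y).1 x
    rw [nabla_sub_nabla_eq_mlieBracket hU _ _ hx, nabla_sub_nabla_eq_mlieBracket hU _ _ hx,
      nabla_sub_nabla_eq_mlieBracket hU _ _ hx, hb X Y Z, hb Y X Z,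
      mlieBracket_swap_apply (W := Z.1), hb Z X Y, ← mlieBracket_swap_apply]
    exact leibniz_identity_mlieBracket_apply (hs X) (hs Y) (hs Z)
  e := e
  sum_g_smul_e X := ext_eq fun x hx ↦ by
    rw [sum_apply]
    refine (Finset.sum_congr rfl fun i _ ↦ smul_apply _ (e i) ⟨x, hx⟩).trans ?_
    exact sum_inner_smul (he x hx) (by simp) (X.1 x)
  d_g_e X i j := SmoothFunctions.ext_eq fun x ↦ by
    have h : SmoothFunctions.ext (metric (e i) (e j)) =ᶠ[𝓝 x.1] fun _ ↦ if i = j then 1 else 0 := by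
      refine Filter.eventually_of_mem (hU.mem_nhds x.2) fun y hy ↦ ?_
      rw [SmoothFunctions.ext_apply _ hy]
      exact orthonormal_iff_ite.mp (he y hy) i j
    refine (congr($(h.mfderiv_eq) (X.1 x))).trans ?_
    rw [mfderiv_const]
    rfl
  smul_left_cancel a h := SmoothFunctions.ext_eq fun x ↦ by
    -- A frame field vanishes nowhere on U, so it detects every function.
    have h₁ : (a • e ⟨0, hE⟩).1 x = 0 := by rw [h]; rfl
    rw [smul_apply] at h₁
    exact (smul_eq_zero.mp h₁).resolve_right ((he x x.2).ne_zero _)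
  two_cancel a h := SmoothFunctions.ext_eq fun x ↦ by
    have h₁ : 2 * a.1 x = 0 := congr(($h).1 x)
    simpa using h₁

variable (hU : IsOpen U) (e : Fin (Module.finrank ℝ E) → SmoothFields E U)
  (he : ∀ x ∈ U, Orthonormal ℝ (fun i ↦ (e i).1 x)) (hE : 0 < Module.finrank ℝ E)

theorem framedConnection_R (X Y Z : SmoothFields E U) {x : M} (hx : x ∈ U) :
    ((framedConnection hU e he hE).R X Y Z).1 x = curvature X.1 Y.1 Z.1 x := by
  rw [curvature, ← nabla_sub_nabla_eq_mlieBracket hU X Y hx]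
  rfl

theorem curvature_restrict (hU : IsOpen U) {X Y Z : Π x : M, TangentSpace 𝓘(ℝ, E) x}
    (hX : CMDiff[U] ∞ (T% X)) (hY : CMDiff[U] ∞ (T% Y)) (hZ : CMDiff[U] ∞ (T% Z)) {x : M}
    (hx : x ∈ U) :
    curvature (restrict X hX).1 (restrict Y hY).1 (restrict Z hZ).1 x = curvature X Y Z x := by
  have h {X Y : Π x : M, TangentSpace 𝓘(ℝ, E) x}
      (hX : CMDiff[U] ∞ (T% X)) (hY : CMDiff[U] ∞ (T% Y)) :
      leviCivita (fun y ↦ leviCivita (restrict Y hY).1 y ((restrict X hX).1 y)) x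
        = leviCivita (fun y ↦ leviCivita Y y (X y)) x := by
    refine leviCivita_congr (mdifferentiableAt hU (nabla hU (restrict X hX) (restrict Y hY)) hx) ?_
    refine Filter.eventually_of_mem (hU.mem_nhds hx) fun y hy ↦ ?_
    change leviCivita (restrict Y hY).1 y ((restrict X hX).1 y) = leviCivita Y y (X y)
    rw [restrict_apply hy, leviCivita_congr (mdifferentiableAt hU (restrict Y hY) hy)
      (restrict_eventuallyEq hU hy)]
  rw [curvature, curvature, h hX hZ, h hY hZ, restrict_apply hx, restrict_apply hx,
    (restrict_eventuallyEq hU hx).mlieBracket_vectorField_eq (restrict_eventuallyEq hU hx),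
    leviCivita_congr (mdifferentiableAt hU (restrict Z hZ) hx) (restrict_eventuallyEq hU hx)]

include hU he hE in
-- Linearity over functions and the frame expansion make T X at x depend on X at x only:
-- tensoriality without bump functions.
theorem linearMap_apply (T : SmoothFields E U →ₗ[SmoothFunctions E U] SmoothFields E U)
    (X : SmoothFields E U) {x : M} (hx : x ∈ U) :
    (T X).1 x = ∑ i, (inner ℝ (X.1 x) ((e i).1 x) : ℝ) • (T (e i)).1 x := by
  conv_lhs => rw [← (framedConnection hU e he hE).sum_g_smul_e X, map_sum, sum_apply]
  refine Finset.sum_congr rfl fun i _ ↦ ?_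
  rw [map_smul]
  exact smul_apply _ _ ⟨x, hx⟩

include hU he hE in
theorem linearMap_apply_congr (T : SmoothFields E U →ₗ[SmoothFunctions E U] SmoothFields E U)
    {X Y : SmoothFields E U} {x : M} (hx : x ∈ U) (h : X.1 x = Y.1 x) : (T X).1 x = (T Y).1 x := by
  rw [linearMap_apply hU e he hE T X hx, linearMap_apply hU e he hE T Y hx, h]

theorem framedConnection_R_congr {X X' Y Y' Z Z' : SmoothFields E U} {x : M} (hx : x ∈ U)
    (hX : X.1 x = X'.1 x) (hY : Y.1 x = Y'.1 x) (hZ : Z.1 x = Z'.1 x) :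
    ((framedConnection hU e he hE).R X Y Z).1 x
      = ((framedConnection hU e he hE).R X' Y' Z').1 x := by
  set C := framedConnection hU e he hE
  have h₁ := linearMap_apply_congr hU e he hE ((C.Rₗ.flip Y).flip Z) hx hX
  have h₂ := linearMap_apply_congr hU e he hE ((C.Rₗ X').flip Z) hx hY
  have h₃ := linearMap_apply_congr hU e he hE (C.Rₗ X' Y') hx hZ
  exact h₁.trans (h₂.trans h₃)

/-- The extensions defining `curvatureAt` are smooth only near x, so both sides are compared on a
smaller open set, where tensoriality applies. -/
theorem curvatureAt_eq (X Y Z : SmoothFields E U) {x : M} (hx : x ∈ U) :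
    curvatureAt x (X.1 x) (Y.1 x) (Z.1 x) = ((framedConnection hU e he hE).R X Y Z).1 x := by
  have hext (u : TangentSpace 𝓘(ℝ, E) x) :=
    FiberBundle.exists_contMDiffOn_extend (k := ∞) 𝓘(ℝ, E) E u
  obtain ⟨s₁, hs₁, h₁⟩ := hext (X.1 x)
  obtain ⟨s₂, hs₂, h₂⟩ := hext (Y.1 x)
  obtain ⟨s₃, hs₃, h₃⟩ := hext (Z.1 x)
  obtain ⟨W, hW, hWo, hxW⟩ := mem_nhds_iff.mp
    (Filter.inter_mem (Filter.inter_mem (hU.mem_nhds hx) hs₁) (Filter.inter_mem hs₂ hs₃))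
  replace h₁ := h₁.mono fun y hy ↦ (hW hy).1.2
  replace h₂ := h₂.mono fun y hy ↦ (hW hy).2.1
  replace h₃ := h₃.mono fun y hy ↦ (hW hy).2.2
  have hWU (X : SmoothFields E U) : CMDiff[W] ∞ (T% X.1) :=
    (contMDiffOn X).mono fun y hy ↦ (hW hy).1.1
  have he' (y) (hy : y ∈ W) : Orthonormal ℝ (fun i ↦ (restrict (e i).1 (hWU (e i))).1 y) := by
    simp only [restrict_apply hy]
    exact he y (hW hy).1.1
  rw [framedConnection_R hU e he hE _ _ _ hx, ← curvature_restrict hWo (hWU X) (hWU Y) (hWU Z) hxW,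
    curvatureAt, ← curvature_restrict hWo h₁ h₂ h₃ hxW, ← framedConnection_R hWo _ he' hE _ _ _ hxW,
    ← framedConnection_R hWo _ he' hE _ _ _ hxW]
  apply framedConnection_R_congr hWo _ he' hE hxW <;>
  simp [restrict_apply hxW]

theorem curvatureAt_eq_sum (X Y : SmoothFields E U) {x : M} (hx : x ∈ U)
    (w : TangentSpace 𝓘(ℝ, E) x) :
    curvatureAt x (X.1 x) (Y.1 x) w
      = ∑ i, (inner ℝ w ((e i).1 x) : ℝ) • ((framedConnection hU e he hE).R X Y (e i)).1 x := by
  have hc (c : ℝ) (X : SmoothFields E U) :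
      ((algebraMap ℝ (SmoothFunctions E U) c) • X).1 x = c • X.1 x :=
    smul_apply _ X ⟨x, hx⟩
  have hw : (∑ i, (algebraMap ℝ (SmoothFunctions E U) (inner ℝ w ((e i).1 x))) • e i).1 x = w := by
    simp only [sum_apply, hc]
    exact sum_inner_smul (he x hx) (by simp) w
  conv_lhs => rw [← hw]
  rw [curvatureAt_eq hU e he hE _ _ _ hx]
  refine (linearMap_apply hU e he hE ((framedConnection hU e he hE).Rₗ X Y) _ hx).trans ?_
  rw [hw]
  rfl

end SmoothFields

/-! ### The geometric structure as an algebraic `Kenmotsu` structure. -/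

namespace WeakMetricFStructure

variable {n s : ℕ} (S : WeakMetricFStructure E M n s)

theorem f_ξ (x : M) (i : Fin s) : S.f x (S.ξ i x) = 0 := by
  have h : S.f x (S.f x (S.ξ i x)) = 0 := by
    rw [S.f_sq, S.Q_ξ]
    simp [S.η_ξ]
  rw [← inner_self_eq_zero (𝕜 := ℝ), S.f_skew, h, inner_zero_right, neg_zero]

/-- The metric compatibility axiom with second argument ξ_i, where f ξ_i = 0 and Q ξ_i = ξ_i. -/
theorem η_eq_inner (x : M) (i : Fin s) (u : TangentSpace 𝓘(ℝ, E) x) :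
    S.η i x u = inner ℝ u (S.ξ i x) := by
  have h := S.inner_f_f x u (S.ξ i x)
  rw [S.f_ξ, S.Q_ξ, inner_zero_right] at h
  simp only [S.η_ξ, mul_ite, mul_one, mul_zero, Finset.sum_ite_eq', Finset.mem_univ, if_true] at h
  linarith

theorem eq_sum_of_f_f_eq_zero {x : M} {u : TangentSpace 𝓘(ℝ, E) x} (h : S.f x (S.f x u) = 0) :
    u = ∑ i, (inner ℝ u (S.ξ i x) : ℝ) • S.ξ i x := by
  apply (S.Q_nonsingular x).1
  rw [S.f_sq, neg_add_eq_zero] at h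
  simp [h, S.Q_ξ, S.η_eq_inner]

/-- The image of f is horizontal, and f ≠ 0 because its rank is 2n > 0: apply f to an extension of a
vector outside its kernel, then shrink to where the result is nonzero. -/
theorem exists_horizontal (hn : 0 < n) (x₀ : M) :
    ∃ W : Set M, IsOpen W ∧ x₀ ∈ W ∧ ∃ X : Π x : M, TangentSpace 𝓘(ℝ, E) x,
      CMDiff[W] ∞ (T% X) ∧ ∀ x ∈ W, X x ≠ 0 ∧ ∀ i, inner ℝ (X x) (S.ξ i x) = 0 := by
  obtain ⟨u, hu⟩ : ∃ u, S.f x₀ u ≠ 0 := by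
    by_contra! h
    have h' : (S.f x₀).toLinearMap = 0 := LinearMap.ext h
    have := S.f_rank x₀
    rw [h', LinearMap.range_zero, finrank_bot] at this
    omega
  obtain ⟨t, ht, htu⟩ := FiberBundle.exists_contMDiffOn_extend (k := ∞) 𝓘(ℝ, E) E u
  obtain ⟨W, hWt, hW, hxW⟩ := mem_nhds_iff.mp ht
  have hX : CMDiff[W] ∞ (T% (fun x ↦ S.f x (FiberBundle.extend E u x))) :=
    (S.contMDiff_f.contMDiffOn (s := W)).clm_bundle_apply (htu.mono hWt)
  have hc := (contMDiffOn_inner hX hX).continuousOn.isOpen_inter_preimage hW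
    (isOpen_compl_singleton (x := (0 : ℝ)))
  refine ⟨_, hc, ⟨hxW, ?_⟩, _, hX.mono Set.inter_subset_left, fun x hx ↦ ⟨fun h ↦ ?_, fun i ↦ ?_⟩⟩
  · simpa using hu
  · simpa [h] using hx.2
  · rw [S.f_skew, S.f_ξ, inner_zero_right, neg_zero]

open SmoothFields

/-- The structure tensor `f` acting on vector fields. -/
def fₗ (U : Set M) : SmoothFields E U →ₗ[SmoothFunctions E U] SmoothFields E U where
  toFun X := ⟨fun x ↦ S.f x (X.1 x), S.contMDiff_f.contMDiffOn.clm_bundle_apply (contMDiffOn X),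
    fun x hx ↦ by beta_reduce; rw [apply_of_notMem X hx, map_zero]⟩
  map_add' X Y := ext_eq fun x hx ↦ map_add (S.f x) _ _
  map_smul' a X := ext_eq fun x hx ↦ map_smul (S.f x) (SmoothFunctions.ext a x) (X.1 x)

theorem fₗ_apply (X : SmoothFields E U) (x : M) : (S.fₗ U X).1 x = S.f x (X.1 x) := rfl

/-- The characteristic fields on an open set. -/
def ξU (U : Set M) (i : Fin s) : SmoothFields E U := restrict (S.ξ i) (S.contMDiff_ξ i).contMDiffOn

theorem ξU_apply {x : M} (hx : x ∈ U) (i : Fin s) : (S.ξU U i).1 x = S.ξ i x := restrict_apply hx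

theorem sum_ξU_apply {x : M} (hx : x ∈ U) : (∑ i, S.ξU U i).1 x = S.ξbar x := by
  simp only [SmoothFields.sum_apply, S.ξU_apply hx, ξbar]

theorem ηbar_eq (x : M) (u : TangentSpace 𝓘(ℝ, E) x) : S.ηbar x u = inner ℝ u (S.ξbar x) := by
  simp [ηbar, ξbar, inner_sum, S.η_eq_inner]

variable (hU : IsOpen U) (e : Fin (Module.finrank ℝ E) → SmoothFields E U)
  (he : ∀ x ∈ U, Orthonormal ℝ (fun i ↦ (e i).1 x)) (hE : 0 < Module.finrank ℝ E)

theorem deriv_algebraMap (X : SmoothFields E U) (c : ℝ) :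
    deriv hU X (algebraMap ℝ (SmoothFunctions E U) c) = 0 := by
  refine SmoothFunctions.ext_eq fun x ↦ ?_
  refine (deriv_restrict hU X (contMDiffOn_const (c := c)) x).trans ?_
  exact congr($(mfderiv_const) (X.1 x))

/-- The weak `βf`-Kenmotsu structure on the fields on an open set. -/
def kenmotsu {β : ℝ} (hβ : β ≠ 0) (hS : S.IsWeakKenmotsu (fun _ ↦ β)) (X₀ : SmoothFields E U)
    (hX₀ : ∀ x ∈ U, X₀.1 x ≠ 0 ∧ ∀ i, inner ℝ (X₀.1 x) (S.ξ i x) = 0) :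
    (framedConnection hU e he hE).Kenmotsu s where
  f := S.fₗ U
  ξ := S.ξU U
  b := algebraMap ℝ _ β
  d_b X := deriv_algebraMap hU X β
  b_cancel a h := SmoothFunctions.ext_eq fun x ↦ by
    have : β * a.1 x = 0 := congr(($h).1 x)
    exact (mul_eq_zero.mp this).resolve_left hβ
  f_skew X Y := SmoothFunctions.ext_eq fun x ↦ S.f_skew x _ _
  g_ξ i j := SmoothFunctions.ext_eq fun x ↦ by
    have h : inner ℝ ((S.ξU U i).1 x) ((S.ξU U j).1 x) = if i = j then (1 : ℝ) else 0 := by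
      rw [S.ξU_apply x.2, S.ξU_apply x.2]
      exact orthonormal_iff_ite.mp (S.ξ_orthonormal x) i j
    refine h.trans ?_
    split_ifs <;> rfl
  f_ξ i := ext_eq fun x hx ↦ by
    rw [fₗ_apply, S.ξU_apply hx, S.f_ξ]; rfl
  eq_of_f_f X h := ext_eq fun x hx ↦ by
    have h₁ : S.f x (S.f x (X.1 x)) = 0 := congr(($h).1 x)
    rw [SmoothFields.sum_apply]
    refine (S.eq_sum_of_f_f_eq_zero h₁).trans (Finset.sum_congr rfl fun i _ ↦ ?_)
    refine Eq.trans ?_ (SmoothFields.smul_apply _ _ ⟨x, hx⟩).symm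
    rw [S.ξU_apply hx]
    change _ = (inner ℝ (X.1 x) ((S.ξU U i).1 x) : ℝ) • _
    rw [S.ξU_apply hx]
  nab_f X Y := ext_eq fun x hx ↦ by
    refine (hS.2 X.1 Y.1 x (contMDiffAt hU X hx) (contMDiffAt hU Y hx)).trans ?_
    symm
    refine (SmoothFields.smul_apply _ _ ⟨x, hx⟩).trans ?_
    change β • ((metric (S.fₗ U X) Y • ∑ i, S.ξU U i).1 x
      - (metric Y (∑ i, S.ξU U i) • S.fₗ U X).1 x) = _
    rw [SmoothFields.smul_apply _ _ ⟨x, hx⟩, SmoothFields.smul_apply _ _ ⟨x, hx⟩, metric_apply,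
      metric_apply, S.sum_ξU_apply hx, S.ηbar_eq]
    rfl
  X₀ := X₀
  g_X₀_ξ i := SmoothFunctions.ext_eq fun x ↦ by
    change inner ℝ (X₀.1 x) ((S.ξU U i).1 x) = (0 : ℝ)
    rw [S.ξU_apply x.2, (hX₀ x x.2).2]
  X₀_cancel a h := SmoothFunctions.ext_eq fun x ↦ by
    have h₁ : (inner ℝ (X₀.1 x) (X₀.1 x) : ℝ) * a.1 x = 0 := congr(($h).1 x)
    exact (mul_eq_zero.mp h₁).resolve_left (inner_self_ne_zero.mpr (hX₀ x x.2).1)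

theorem kenmotsu_ρ {β : ℝ} (hβ : β ≠ 0) (hS : S.IsWeakKenmotsu (fun _ ↦ β)) (X₀ : SmoothFields E U)
    (hX₀ : ∀ x ∈ U, X₀.1 x ≠ 0 ∧ ∀ i, inner ℝ (X₀.1 x) (S.ξ i x) = 0)
    (X Y : SmoothFields E U) (x : U) :
    ((S.kenmotsu hU e he hE hβ hS X₀ hX₀).ρ X (S.fₗ U Y)).1 x
      = 2 * S.starRicci x (X.1 x) (Y.1 x) := by
  have h₁ : ((S.kenmotsu hU e he hE hβ hS X₀ hX₀).ρ X (S.fₗ U Y)).1 x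
      = ∑ i, inner ℝ ((e i).1 x)
        (S.f x (((framedConnection hU e he hE).R X (S.fₗ U Y) (e i)).1 x)) := by
    rw [FramedConnection.Kenmotsu.ρ, FramedConnection.tr, AddSubmonoidClass.coe_finsetSum,
      Finset.sum_apply]
    rfl
  have h₂ : S.starRicci x (X.1 x) (Y.1 x) = (1 / 2 : ℝ) * ∑ i,
      inner ℝ ((e i).1 x) (S.f x (((framedConnection hU e he hE).R X (S.fₗ U Y) (e i)).1 x)) := by
    -- The trace in `starRicci` uses another orthonormal basis than the frame; expanding the
    -- curvature in the frame and swapping the sums lets Parseval's identity remove b.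
    set b := stdOrthonormalBasis ℝ (TangentSpace 𝓘(ℝ, E) x.1)
    generalize hr : (fun i ↦ ((framedConnection hU e he hE).R X (S.fₗ U Y) (e i)).1 x.1) = r
    have hr' (i) : ((framedConnection hU e he hE).R X (S.fₗ U Y) (e i)).1 x.1 = r i := congr($hr i)
    have hc (w) : curvatureAt x.1 (X.1 x) (S.f x (Y.1 x)) w
        = ∑ i, (inner ℝ w ((e i).1 x) : ℝ) • r i := by
      simp only [← hr']
      exact curvatureAt_eq_sum hU e he hE X (S.fₗ U Y) x.2 w
    simp only [starRicci, hc, map_sum, map_smul, inner_sum, real_inner_smul_right, hr']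
    rw [Finset.sum_comm]
    congr 1
    refine Finset.sum_congr rfl fun i _ ↦ ?_
    rw [← b.sum_inner_mul_inner]
    exact Finset.sum_congr rfl fun j _ ↦ by rw [real_inner_comm]
  rw [h₁, h₂]
  ring

theorem lieDerivMetric_eq {V X Y : Π x : M, TangentSpace 𝓘(ℝ, E) x} {x : M}
    (hV : MDiffAt (T% V) x) (hX : MDiffAt (T% X) x) (hY : MDiffAt (T% Y) x) :
    lieDerivMetric V X Y x
      = inner ℝ (leviCivita V x (X x)) (Y x) + inner ℝ (X x) (leviCivita V x (Y x)) := by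
  have ht {Y : Π x : M, TangentSpace 𝓘(ℝ, E) x} (hY : MDiffAt (T% Y) x) :=
    (CovariantDerivative.torsion_eq_zero_iff _).mp (leviCivita_torsion (E := E) (M := M)) hV hY
  rw [lieDerivMetric, dirDerivInner, leviCivita_metric hV hX hY, ← ht hX, ← ht hY,
    inner_sub_left, inner_sub_right]
  ring

theorem soliton {β : ℝ} (hβ : β ≠ 0) (hS : S.IsWeakKenmotsu (fun _ ↦ β)) (X₀ : SmoothFields E U)
    (hX₀ : ∀ x ∈ U, X₀.1 x ≠ 0 ∧ ∀ i, inner ℝ (X₀.1 x) (S.ξ i x) = 0)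
    {V : Π x : M, TangentSpace 𝓘(ℝ, E) x} {lam : ℝ} (hV : S.IsStarRicciSoliton V lam) :
    (S.kenmotsu hU e he hE hβ hS X₀ hX₀).Soliton (restrict V hV.1.contMDiffOn)
      (algebraMap ℝ _ lam) := fun X Y ↦ SmoothFunctions.ext_eq fun x ↦ by
  set V' : SmoothFields E U := restrict V hV.1.contMDiffOn with hV'
  have h := hV.2 X.1 Y.1 x (contMDiffAt hU X x.2) (contMDiffAt hU Y x.2)
  have hd : MDiffAt (T% V) x.1 := hV.1.mdifferentiable (by simp) x.1
  rw [lieDerivMetric_eq hd (mdifferentiableAt hU X x.2) (mdifferentiableAt hU Y x.2),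
    ← leviCivita_congr (mdifferentiableAt hU V' x.2) (restrict_eventuallyEq hU x.2)] at h
  have hρ := S.kenmotsu_ρ hU e he hE hβ hS X₀ hX₀ X Y x
  change (inner ℝ (leviCivita V'.1 x (X.1 x)) (Y.1 x) : ℝ)
    + inner ℝ (X.1 x) (leviCivita V'.1 x (Y.1 x))
    + ((S.kenmotsu hU e he hE hβ hS X₀ hX₀).ρ X (S.fₗ U Y)).1 x
    = 2 * lam * (inner ℝ (X.1 x) (Y.1 x)
      - (∑ i, metric X (S.ξU U i) * metric Y (S.ξU U i)).1 x)
      + 2 * lam * (inner ℝ (X.1 x) ((∑ i, S.ξU U i).1 x) * inner ℝ (Y.1 x) ((∑ i, S.ξU U i).1 x))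
  have hs : (∑ i, metric X (S.ξU U i) * metric Y (S.ξU U i)).1 x
      = ∑ i, S.η i x (X.1 x) * S.η i x (Y.1 x) := by
    rw [AddSubmonoidClass.coe_finsetSum, Finset.sum_apply]
    refine Finset.sum_congr rfl fun i _ ↦ ?_
    rw [S.η_eq_inner, S.η_eq_inner, ← S.ξU_apply x.2]
    rfl
  rw [hρ, hs, S.sum_ξU_apply x.2, ← S.ηbar_eq, ← S.ηbar_eq]
  linarith

theorem IsStarRicciSoliton.eq_zero [Nonempty M] (hn : 0 < n) (hs : 0 < s) {β : ℝ} (hβ : β ≠ 0)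
    (hS : S.IsWeakKenmotsu (fun _ ↦ β)) {V : Π x : M, TangentSpace 𝓘(ℝ, E) x} {lam : ℝ}
    (hV : S.IsStarRicciSoliton V lam) : lam = 0 := by
  obtain ⟨x₀⟩ := ‹Nonempty M›
  have hE : 0 < Module.finrank ℝ E := by rw [S.dim_eq]; omega
  obtain ⟨W₁, hW₁, hx₁, e, he, heo⟩ := exists_orthonormalFrame (E := E) x₀
  obtain ⟨W₂, hW₂, hx₂, X₀, hX₀, hX₀'⟩ := S.exists_horizontal hn x₀
  have hU := hW₁.inter hW₂
  have hX : CMDiff[W₁ ∩ W₂] ∞ (T% X₀) := hX₀.mono Set.inter_subset_right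
  have he' (i) : CMDiff[W₁ ∩ W₂] ∞ (T% (e i)) := (he i).mono Set.inter_subset_left
  have h := (S.soliton hU (fun i ↦ restrict (e i) (he' i))
    (fun x hx ↦ by simpa only [restrict_apply hx] using heo x hx.1) hE hβ hS (restrict X₀ hX)
    (fun x hx ↦ by simpa only [restrict_apply hx] using hX₀' x hx.2) hV).eq_zero
    fun X ↦ deriv_algebraMap hU X lam
  -- Evaluation at x₀ turns the identity between functions into one between real numbers.
  have h₁ : (s : ℝ) ^ 3 * lam = 0 := congr(($h).1 ⟨x₀, hx₁, hx₂⟩)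
  simpa [hs.ne'] using h₁

end WeakMetricFStructure

end Riemannian

end WeakKenmotsu

end

theorem corollary3
    {E : Type*} [NormedAddCommGroup E] [NormedSpace ℝ E] [FiniteDimensional ℝ E]
    {M : Type*} [TopologicalSpace M] [T2Space M] [SecondCountableTopology M] [Nonempty M]
    [ChartedSpace E M] [IsManifold 𝓘(ℝ, E) ∞ M]
    [RiemannianBundle (fun x : M ↦ TangentSpace 𝓘(ℝ, E) x)]
    [IsContMDiffRiemannianBundle 𝓘(ℝ, E) ∞ E (fun x : M ↦ TangentSpace 𝓘(ℝ, E) x)]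
    {n s : ℕ} (hn : 0 < n) (hs : 0 < s)
    (S : WeakKenmotsu.WeakMetricFStructure E M n s)
    (β : ℝ) (hβ : β ≠ 0) (hS : S.IsWeakKenmotsu (fun _ ↦ β))
    (V : Π x : M, TangentSpace 𝓘(ℝ, E) x) (lam : ℝ)
    (hV : S.IsStarRicciSoliton V lam) :
    lam = 0 :=
  hV.eq_zero S hn hs hβ hS
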